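/- **Setting.** For $d\ge 1$ let $G'_d$ be a glued-trees graph of depth $d$: two perfect binary trees of depth $d$, with roots $\mathtt{Entrance}$ and $\mathtt{Exit}$, together with the edges of a cycle through all $2\cdot 2^d$ leaves that alternates between the leaves of the two trees (any such cycle is allowed). Let $A$ be its adjacency matrix and let $H=A/\sqrt2$ be the Hamiltonian; between the normalized column states (uniform superpositions of the vertices at a given distance from $\mathtt{Entrance}$), $H$ has entries $1$ inside a tree and $\sqrt2$ between the two columns of leaves. For $T>0$ and an integer $k\ge1$ let $$\bar p_{T,k}=\mathbb E\,\bigl|\langle \mathtt{Exit}|e^{-iHt}|\mathtt{Entrance}\rangle\bigr|^2,\qquad t=t_1+\dots+t_k,\quad t_1,\dots,t_k \text{ i.i.d. uniform on } [0,T].$$ The hitting time of this procedure is $kT/\bar p_{T,k}$, the ratio of the maximal evolution time to the mean probability of finding $\mathtt{Exit}$ (it is $\infty$ if $\bar p_{T,k}=0$); its minimum over $T$ is $\tau_k=\inf_{T>0}kT/\bar p_{T,k}$. **Algorithm.** Given $n$, put $T=64n$ and $k=\lceil\log_2(5n)\rceil$. Repeat $20n$ times, independently: start in $|\mathtt{Entrance}\rangle$,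 evolve under $H$ for a time that is the sum of $k$ i.i.d. uniform times on $[0,T]$, and measure in the vertex basis. The algorithm succeeds if $\mathtt{Exit}$ is measured in some repetition. **Statement.** There are constants $C,c>0$ and $N\in\mathbb N$ such that for all $n\ge N$, for $d=n$ as well as for $d=n-1$, and for every choice of the alternating cycle in $G'_d$, with $T=64n$ and $k=\lceil\log_2(5n)\rceil$: 1. the hitting time satisfies $kT/\bar p_{T,k}\le C\,n^2\log n$, and hence $\tau_k\le C\,n^2\log n$; 2. the total evolution time of all $20n$ repetitions is almost surely at most $C\,n^2\log n$, and the algorithm succeeds with probability at least $c$. Thus the hitting time is $O(n^2\log n)$. This improves on the bound $O(n^5)$ previously proved by Childs et al.: $n^2\log n=o(n^5)$. -/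

import Mathlib

open MeasureTheory Filter
open scoped ENNReal

/-! ### Continuous-time quantum walks with a random evolution time -/

section Walk

variable {V : Type*} [Fintype V] [DecidableEq V]

/-- `|⟨y| e^{-iHt} |ψ⟩|²`: the probability of measuring the vertex `y` after evolving the initial
state `ψ` under the Hamiltonian `H` for the time `t`. -/
noncomputable def walkProb (H : Matrix V V ℂ) (ψ : V → ℂ) (y : V) (t : ℝ) : ℝ :=
  ‖(NormedSpace.exp ((-(Complex.I * (t : ℂ))) • H)).mulVec ψ y‖ ^ 2

/-- The law of `t₁ + ⋯ + t_k`, where `t₁, …, t_k` are i.i.d. uniform on `[0, T]`. -/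
noncomputable def sumUniformLaw (T : ℝ) (k : ℕ) : Measure ℝ :=
  (Measure.pi fun _ : Fin k => ProbabilityTheory.cond volume (Set.Icc 0 T)).map
    fun t => ∑ j, t j

/-- The mean probability of measuring `y` when the evolution time is a sum of `k` i.i.d.
uniform times on `[0, T]`. For `k = 1` this is `(1/T) ∫₀ᵀ |⟨y| e^{-iHt} |ψ⟩|² dt`. -/
noncomputable def meanProb (H : Matrix V V ℂ) (ψ : V → ℂ) (y : V) (T : ℝ) (k : ℕ) : ℝ≥0∞ :=
  ∫⁻ t, ENNReal.ofReal (walkProb H ψ y t) ∂(sumUniformLaw T k)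

/-- The ratio of the maximal evolution time `kT` to the mean probability of measuring `y`.
It is `∞` if `T > 0`, `k > 0` and `y` is never found. -/
noncomputable def hittingRatio (H : Matrix V V ℂ) (ψ : V → ℂ) (y : V) (T : ℝ) (k : ℕ) : ℝ≥0∞ :=
  ENNReal.ofReal (k * T) / meanProb H ψ y T k

/-- The quantum hitting time of the walk whose evolution time is a sum of `k` i.i.d. uniform
times, minimized over the length `T > 0` of the interval. -/
noncomputable def hittingTime (H : Matrix V V ℂ) (ψ : V → ℂ) (y : V) (k : ℕ) : ℝ≥0∞ :=
  ⨅ (T : ℝ) (_ : 0 < T), hittingRatio H ψ y T k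

/-- One round: draw `t` as a sum of `k` i.i.d. uniform times on `[0, T]`, evolve `ψ` for time `t`
and measure in the vertex basis. This is the joint law of `t` and of the measured vertex. -/
noncomputable def roundLaw [MeasurableSpace V] (H : Matrix V V ℂ) (ψ : V → ℂ) (T : ℝ) (k : ℕ) :
    Measure (ℝ × V) :=
  ∑ v, ((sumUniformLaw T k).withDensity fun t => ENNReal.ofReal (walkProb H ψ v t)).map
    fun t => (t, v)

/-- The joint law of the evolution times and measured vertices in `R` independent rounds. -/
noncomputable def repeatedWalkLaw [MeasurableSpace V] (H : Matrix V V ℂ) (ψ : V → ℂ) (T : ℝ)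
    (k R : ℕ) : Measure (Fin R → ℝ × V) :=
  Measure.pi fun _ => roundLaw H ψ T k

end Walk

/-! ### The glued-trees graph -/

/-- Vertices of two perfect binary trees of depth `d`: the tree (`false` is the one rooted at
`Entrance`, `true` the one rooted at `Exit`), the depth, and the position at that depth. -/
structure GluedVertex (d : ℕ) where
  side : Bool
  depth : Fin (d + 1)
  pos : Fin (2 ^ (depth : ℕ))
deriving DecidableEq, Fintype

namespace GluedVertex

variable {d : ℕ}

instance : MeasurableSpace (GluedVertex d) := ⊤

/-- The root of the first tree. -/
def entrance : GluedVertex d := ⟨false, 0, ⟨0, by simp⟩⟩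

/-- The root of the second tree. -/
def exit : GluedVertex d := ⟨true, 0, ⟨0, by simp⟩⟩

/-- `u` is the parent of `v` in one of the trees. -/
def IsParent (u v : GluedVertex d) : Prop :=
  u.side = v.side ∧ (u.depth : ℕ) + 1 = v.depth ∧ (u.pos : ℕ) = v.pos / 2

/-- The leaves of the first tree listed as `a 0, a 1, …` and those of the second one as
`b 0, b 1, …`, the edges of the cycle `a 0, b 0, a 1, b 1, …, a (2 ^ d - 1), b (2 ^ d - 1), a 0`.
Here `i + 1` is taken modulo `2 ^ d`. Every cycle through all the leaves that alternates between
the two trees has this form. -/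
def IsCycleEdge (a b : Equiv.Perm (Fin (2 ^ d))) (u v : GluedVertex d) : Prop :=
  u.side = false ∧ v.side = true ∧ (u.depth : ℕ) = d ∧ (v.depth : ℕ) = d ∧
    ∃ i : Fin (2 ^ d), ((u.pos : ℕ) = a i ∨ (u.pos : ℕ) = a (i + 1)) ∧ (v.pos : ℕ) = b i

end GluedVertex

/-- The graph made of two binary trees of depth `d` and the alternating cycle through their leaves
that is given by the enumerations `a` and `b` of the leaves. -/
def gluedTrees {d : ℕ} (a b : Equiv.Perm (Fin (2 ^ d))) : SimpleGraph (GluedVertex d) :=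
  SimpleGraph.fromRel fun u v => u.IsParent v ∨ GluedVertex.IsCycleEdge a b u v

open Classical in
/-- The walk Hamiltonian: the adjacency matrix divided by `√2`. Between the normalized column
states its entries are `1` within a tree and `√2` between the two columns of leaves. -/
noncomputable def gluedTreesHamiltonian {d : ℕ} (a b : Equiv.Perm (Fin (2 ^ d))) :
    Matrix (GluedVertex d) (GluedVertex d) ℂ :=
  ((1 / Real.sqrt 2 : ℝ) : ℂ) • (gluedTrees a b).adjMatrix ℂ

/-!
The walk started at the entrance stays in the span of the column states, and the mirror symmetry of
the columns splits this span into a symmetric (`s = 1`) and an antisymmetric (`s = -1`) part. On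
each of them the Hamiltonian is that of a path with `m = d + 1` sites, hopping `1`, and the
potential `s √2` at the last site. With `x_i` the eigenvalues of the two paths and `p_i` their
spectral weights at the first site, the amplitude of the exit at time `t` is
`∑ s p_i / 2 * exp (-i x_i t)` (`walkProb_exit`), where the coefficients have absolute sum `1`.

Averaging the square of the amplitude over `t` multiplies the cross term of `x_i` and `x_j` by the
characteristic function of the random time at `x_j - x_i` (`sum_sq_sub_le_integral`). The diagonal
is at least `1 / (2m)` by Cauchy–Schwarz. The characteristic function of a sum of `k` uniform times
is at most `(2 / (T |x_j - x_i|)) ^ k`, and for `|x_j - x_i| ≥ 1 / (16 n)` this is at most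
`2 ^ (-k) ≤ 1 / (5 n)`, so all these cross terms together are at most `1 / (5 n)`.

What remains are pairs of eigenvalues closer than `1 / (16 n)`, for which the random time has no
effect. Eigenvalues outside `(-2, 2)` have weight `O(1 / m³)`. The others are `2 cos θ` with
`sin ((m + 1) θ) = s √2 sin (m θ)`, and their weight is about `2 sin² θ / m`. Such angles of the
same sign are `3 / (2m)`-separated (`IsRootAngle.separated`), and those of opposite signs repel each
other (`IsRootAngle.repulsion`) strongly enough that near coincidences of eigenvalues occur only
near `±2`, where the weights are small. The eigenvalues near a given one thus have total weight
`∑ p_j / 2` at most about `0.16 / n` (`sum_weight_near`), and the mean probability is at least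
`1 / (10 n)` (`meanProb_exit_lower`). The hitting time and the success probability of `20 n` independent rounds
follow.
-/

/-! ### The quantization condition `sin ((m + 1) θ) = ± √2 sin (m θ)` -/

/-- The angles `θ ∈ (0, π)` for which `2 cos θ` is an eigenvalue of the `m`-site path whose last
site carries the potential `s √2`. -/
structure IsRootAngle (m : ℕ) (s θ : ℝ) : Prop where
  sign : s ^ 2 = 1
  pos : 0 < θ
  lt_pi : θ < Real.pi
  eq : Real.sin ((m + 1) * θ) = s * √2 * Real.sin (m * θ)

namespace IsRootAngle

variable {m : ℕ} {s θ θ' : ℝ}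

lemma sin_pos (h : IsRootAngle m s θ) : 0 < Real.sin θ :=
  Real.sin_pos_of_pos_of_lt_pi h.pos h.lt_pi

lemma abs_sign (h : IsRootAngle m s θ) : |s| = 1 := by
  rcases (sq_eq_one_iff.1 h.sign) with rfl | rfl <;> simp

/-- The unit vector `(cos mθ, sin mθ)` is a multiple of `(s√2 - cos θ, sin θ)`. -/
lemma exists_scale (h : IsRootAngle m s θ) :
    ∃ r : ℝ, Real.cos (m * θ) = r * (s * √2 - Real.cos θ) ∧ Real.sin (m * θ) = r * Real.sin θ ∧
      r ^ 2 * (3 - 2 * √2 * s * Real.cos θ) = 1 := by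
  have hs := h.sin_pos
  have e := h.eq
  rw [show ((m : ℝ) + 1) * θ = m * θ + θ by ring, Real.sin_add] at e
  have h2 : √2 ^ 2 = (2 : ℝ) := Real.sq_sqrt (by norm_num)
  have hc : Real.cos (m * θ) = Real.sin (m * θ) / Real.sin θ * (s * √2 - Real.cos θ) := by
    field_simp
    linarith
  have hr : Real.sin (m * θ) = Real.sin (m * θ) / Real.sin θ * Real.sin θ := by field_simp
  refine ⟨Real.sin (m * θ) / Real.sin θ, hc, hr, ?_⟩
  set r := Real.sin (m * θ) / Real.sin θ
  have h1 := Real.sin_sq_add_cos_sq (m * θ)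
  rw [hc, hr] at h1
  have h3 := Real.sin_sq_add_cos_sq θ
  have h4 := h.sign
  linear_combination h1 - r ^ 2 * h3 - r ^ 2 * s ^ 2 * h2 - 2 * r ^ 2 * h4

/-- The squared length of `(s√2 - cos θ, sin θ)` is at least `(√2 - 1)² > 0.17`. -/
lemma length_sq_lower (h : IsRootAngle m s θ) : 0.17 ≤ 3 - 2 * √2 * s * Real.cos θ := by
  have h2 : √2 < 1.415 := by
    rw [Real.sqrt_lt' (by norm_num)]; norm_num
  have : |s * Real.cos θ| ≤ 1 := by
    rw [abs_mul, h.abs_sign, one_mul]; exact Real.abs_cos_le_one θ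
  have := (abs_le.1 this).2
  nlinarith [Real.sqrt_nonneg 2]

/-- The phases of two roots differ by the angle between the vectors `(s√2 - cos θ, sin θ)`. -/
lemma sin_sq_mul_sub {s' : ℝ} (h : IsRootAngle m s θ) (h' : IsRootAngle m s' θ') :
    Real.sin (m * (θ' - θ)) ^ 2 *
      ((3 - 2 * √2 * s * Real.cos θ) * (3 - 2 * √2 * s' * Real.cos θ')) =
    (√2 * (s * Real.sin θ' - s' * Real.sin θ) - Real.sin (θ' - θ)) ^ 2 := by
  obtain ⟨r, hc, hs, hr⟩ := h.exists_scale
  obtain ⟨r', hc', hs', hr'⟩ := h'.exists_scale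
  rw [mul_sub, Real.sin_sub, Real.sin_sub, hc, hs, hc', hs']
  calc _ = (r ^ 2 * (3 - 2 * √2 * s * Real.cos θ)) * (r' ^ 2 * (3 - 2 * √2 * s' * Real.cos θ')) *
        (√2 * (s * Real.sin θ' - s' * Real.sin θ) -
          (Real.sin θ' * Real.cos θ - Real.cos θ' * Real.sin θ)) ^ 2 := by ring
    _ = _ := by rw [hr, hr']; ring

/-- Two roots of the same sign are at distance at least `3 / (2m)`. -/
lemma separated (hm : 30 ≤ m) (h : IsRootAngle m s θ) (h' : IsRootAngle m s θ') (hne : θ ≠ θ') :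
    1.5 / m ≤ |θ' - θ| := by
  -- at a smaller distance `|sin (m D)| ≥ 0.63 m |D|`, whereas the cross product of the two vectors
  -- `(s√2 - cos θ, sin θ)` is at most `2.415 |D|`
  by_contra! hlt
  have hm' : (30 : ℝ) ≤ m := by exact_mod_cast hm
  have hD : 0 < |θ' - θ| := abs_pos.2 (sub_ne_zero.2 hne.symm)
  rw [lt_div_iff₀ (by linarith)] at hlt
  have hsin : 0.63 * (m * |θ' - θ|) ≤ |Real.sin (m * (θ' - θ))| := by
    have h1 : 2 / Real.pi * (m * |θ' - θ|) ≤ Real.sin (m * |θ' - θ|) :=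
      Real.mul_le_sin (by positivity) (by linarith [Real.pi_gt_d2])
    have h2 : (0.63 : ℝ) ≤ 2 / Real.pi := by
      rw [le_div_iff₀ Real.pi_pos]; linarith [Real.pi_lt_d2]
    have h3 : Real.sin (m * |θ' - θ|) ≤ |Real.sin (m * (θ' - θ))| := by
      rcases abs_cases (θ' - θ) with ⟨e, -⟩ | ⟨e, -⟩ <;> rw [e]
      · exact le_abs_self _
      · rw [mul_neg, Real.sin_neg]; exact neg_le_abs _
    have : 0 ≤ m * |θ' - θ| := by positivity
    nlinarith
  have key := h.sin_sq_mul_sub h'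
  have h2 : √2 < 1.415 := by
    rw [Real.sqrt_lt' (by norm_num)]; norm_num
  have hcross : |√2 * (s * Real.sin θ' - s * Real.sin θ) - Real.sin (θ' - θ)|
      ≤ 2.415 * |θ' - θ| := by
    have h3 : |Real.sin (θ' - θ)| ≤ |θ' - θ| := Real.abs_sin_le_abs
    have h4 : |Real.sin θ' - Real.sin θ| ≤ |θ' - θ| := by
      have := Real.abs_sin_sub_sin_le θ' θ
      exact this
    have h5 : |√2 * (s * Real.sin θ' - s * Real.sin θ)| ≤ 1.415 * |θ' - θ| := by
      rw [← mul_sub, abs_mul, abs_mul, h.abs_sign, one_mul, abs_of_nonneg (Real.sqrt_nonneg 2)]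
      exact mul_le_mul h2.le h4 (abs_nonneg _) (by norm_num)
    have h6 := norm_sub_le (√2 * (s * Real.sin θ' - s * Real.sin θ)) (Real.sin (θ' - θ))
    simp only [Real.norm_eq_abs] at h6
    linarith
  have w1 := h.length_sq_lower
  have w2 := h'.length_sq_lower
  have hsq1 : (0.63 * (m * |θ' - θ|)) ^ 2 ≤ Real.sin (m * (θ' - θ)) ^ 2 := by
    rw [← sq_abs (Real.sin _)]; gcongr
  have hsq2 : (√2 * (s * Real.sin θ' - s * Real.sin θ) - Real.sin (θ' - θ)) ^ 2
      ≤ (2.415 * |θ' - θ|) ^ 2 := by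
    rw [← sq_abs (_ - _)]; gcongr
  have hw : (0.17 : ℝ) * 0.17 ≤
      (3 - 2 * √2 * s * Real.cos θ) * (3 - 2 * √2 * s * Real.cos θ') := by gcongr
  have : (0.63 * (m * |θ' - θ|)) ^ 2 * (0.17 * 0.17) ≤ (2.415 * |θ' - θ|) ^ 2 := by
    calc _ ≤ Real.sin (m * (θ' - θ)) ^ 2 *
      ((3 - 2 * √2 * s * Real.cos θ) * (3 - 2 * √2 * s * Real.cos θ')) := by gcongr
      _ ≤ _ := by rw [key]; exact hsq2
  have hD2 : 0 < |θ' - θ| ^ 2 := by positivity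
  have hm2 : (900 : ℝ) ≤ (m : ℝ) ^ 2 := by nlinarith
  nlinarith

/-- Two roots of opposite signs repel each other, but only weakly near `0` and `π`. -/
lemma repulsion (h : IsRootAngle m s θ) (h' : IsRootAngle m (-s) θ') :
    √2 * (Real.sin θ + Real.sin θ') ≤ |θ' - θ| + m * |θ' - θ| * (3 + √2 * |θ' - θ|) := by
  have key := h.sin_sq_mul_sub h'
  set W := 3 - 2 * √2 * s * Real.cos θ
  set W' := 3 - 2 * √2 * (-s) * Real.cos θ'
  set D := |θ' - θ|
  have w1 : 0.17 ≤ W := h.length_sq_lower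
  have w2 : 0.17 ≤ W' := h'.length_sq_lower
  have hD : 0 ≤ D := abs_nonneg _
  have hWW : (W + W') / 2 ≤ 3 + √2 * D := by
    have h4 : |Real.cos θ' - Real.cos θ| ≤ D := Real.abs_cos_sub_cos_le θ' θ
    have h5 : s * (Real.cos θ' - Real.cos θ) ≤ D := by
      refine (le_abs_self _).trans ?_
      rwa [abs_mul, h.abs_sign, one_mul]
    have : (W + W') / 2 = 3 + √2 * (s * (Real.cos θ' - Real.cos θ)) := by simp only [W, W']; ring
    rw [this]; gcongr
  have hsin : |Real.sin (m * (θ' - θ))| ≤ m * D := by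
    refine Real.abs_sin_le_abs.trans ?_
    rw [abs_mul, Nat.abs_cast]
  have h1 : |√2 * (s * Real.sin θ' - (-s) * Real.sin θ) - Real.sin (θ' - θ)|
      ≤ m * D * (3 + √2 * D) := by
    apply abs_le_of_sq_le_sq _ (by positivity)
    rw [← key, mul_pow, ← sq_abs (Real.sin _)]
    gcongr ?_ ^ 2 * ?_
    have : W * W' ≤ ((W + W') / 2) ^ 2 := by nlinarith [sq_nonneg (W - W')]
    exact this.trans (by gcongr)
  have h2 : √2 * (Real.sin θ + Real.sin θ') =
      |√2 * (s * Real.sin θ' - (-s) * Real.sin θ)| := by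
    rw [show s * Real.sin θ' - (-s) * Real.sin θ = s * (Real.sin θ + Real.sin θ') by ring,
      abs_mul, abs_mul, h.abs_sign, one_mul, abs_of_nonneg (Real.sqrt_nonneg 2),
      abs_of_pos (add_pos h.sin_pos h'.sin_pos)]
  have h3 : |Real.sin (θ' - θ)| ≤ D := Real.abs_sin_le_abs
  rw [h2]
  have := abs_sub_abs_le_abs_sub (√2 * (s * Real.sin θ' - (-s) * Real.sin θ)) (Real.sin (θ' - θ))
  linarith

end IsRootAngle

lemma two_mul_sin_mul_sum_sin_sq (m : ℕ) (θ : ℝ) :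
    2 * Real.sin θ * ∑ j ∈ Finset.range m, Real.sin ((j + 1) * θ) ^ 2 =
      m * Real.sin θ - Real.cos ((m + 1) * θ) * Real.sin (m * θ) := by
  induction m with
  | zero => simp
  | succ m ih =>
    rw [Finset.sum_range_succ, mul_add, ih]
    push_cast
    rw [show ((m : ℝ) + 1 + 1) * θ = (m + 1) * θ + θ by ring,
      show (m : ℝ) * θ = (m + 1) * θ - θ by ring, Real.cos_add, Real.sin_sub]
    linear_combination Real.sin θ * Real.sin_sq_add_cos_sq ((m + 1) * θ)

/-- At a root angle `|sin (m θ) / sin θ| ≤ 1 / (√2 - 1)`, so the oscillating part of the sum of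
squares is bounded. -/
lemma IsRootAngle.sum_sin_sq_lower {m : ℕ} {s θ : ℝ} (h : IsRootAngle m s θ) :
    m / 2 - 1.25 ≤ ∑ j ∈ Finset.range m, Real.sin ((j + 1) * θ) ^ 2 := by
  obtain ⟨r, hc, hs, hr⟩ := h.exists_scale
  have hr' : |r| ≤ 2.5 := by
    apply abs_le_of_sq_le_sq _ (by norm_num)
    nlinarith [h.length_sq_lower, sq_nonneg r]
  have key := two_mul_sin_mul_sum_sin_sq m θ
  have h1 : Real.cos ((m + 1) * θ) * r ≤ 2.5 := by
    refine (le_abs_self _).trans ?_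
    rw [abs_mul]
    calc _ ≤ 1 * (2.5 : ℝ) :=
          mul_le_mul (Real.abs_cos_le_one _) hr' (abs_nonneg _) zero_le_one
      _ = _ := by norm_num
  rw [hs] at key
  have : 2 * ∑ j ∈ Finset.range m, Real.sin ((j + 1) * θ) ^ 2
      = m - Real.cos ((m + 1) * θ) * r := by
    have := h.sin_pos.ne'
    apply mul_left_cancel₀ this
    linarith
  linarith

/-! ### Separated angles in a short window of cosines -/

lemma sin_add_sin_le_of_separated {x y σ : ℝ} (hx : 0 ≤ x) (hy : y ≤ Real.pi) (hσ : 0 < σ)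
    (hxy : x + σ ≤ y) :
    Real.sin x + Real.sin y ≤ Real.pi / σ * (Real.cos x - Real.cos y) := by
  have hS : 0 ≤ Real.sin ((x + y) / 2) :=
    Real.sin_nonneg_of_nonneg_of_le_pi (by linarith) (by linarith)
  have h1 : Real.sin x + Real.sin y = 2 * Real.sin ((x + y) / 2) * Real.cos ((x - y) / 2) :=
    Real.sin_add_sin x y
  have h2 : Real.cos x - Real.cos y = 2 * Real.sin ((x + y) / 2) * Real.sin ((y - x) / 2) := by
    rw [Real.cos_sub_cos, show (x - y) / 2 = -((y - x) / 2) by ring, Real.sin_neg]; ring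
  have h3 : σ / Real.pi ≤ Real.sin ((y - x) / 2) := by
    have := Real.mul_le_sin (x := (y - x) / 2) (by linarith) (by linarith)
    refine le_trans ?_ this
    rw [show 2 / Real.pi * ((y - x) / 2) = (y - x) / Real.pi by ring]
    gcongr; linarith
  rw [h1, h2]
  calc _ ≤ 2 * Real.sin ((x + y) / 2) * 1 := by gcongr; exact Real.cos_le_one _
    _ = 2 * Real.sin ((x + y) / 2) * (Real.pi / σ * (σ / Real.pi)) := by
      congr 1; field_simp
    _ ≤ 2 * Real.sin ((x + y) / 2) * (Real.pi / σ * Real.sin ((y - x) / 2)) := by gcongr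
    _ = _ := by ring

lemma sum_sin_add_sin_le (P : Finset ℝ) {lo σ : ℝ} (hlo : 0 ≤ lo) (hσ : 0 < σ)
    (hP : ∀ x ∈ P, lo ≤ x) (hsep : ∀ x ∈ P, ∀ y ∈ P, x < y → x + σ ≤ y) (hne : P.Nonempty)
    {a : ℝ} (ha : a ≤ Real.pi) (hPa : ∀ x ∈ P, x + σ ≤ a) :
    ∑ x ∈ P, Real.sin x + Real.sin a ≤ Real.pi / σ * (Real.cos lo - Real.cos a) := by
  induction P using Finset.induction_on_max generalizing a with
  | empty => simp at hne
  | insert b P hb ih =>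
    rw [Finset.sum_insert (fun h => lt_irrefl _ (hb _ h))]
    have hba := hPa b (by simp)
    have hlob := hP b (by simp)
    have h1 := sin_add_sin_le_of_separated (hlo.trans hlob) ha hσ hba
    rcases P.eq_empty_or_nonempty with rfl | hne'
    · rw [Finset.sum_empty, add_zero]
      have : Real.cos b ≤ Real.cos lo :=
        Real.cos_le_cos_of_nonneg_of_le_pi hlo (by linarith) hlob
      calc _ ≤ _ := h1
        _ ≤ _ := by gcongr
    · have h2 := ih (fun x hx => hP x (by simp [hx]))
        (fun x hx y hy => hsep x (by simp [hx]) y (by simp [hy])) hne' (by linarith)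
        (fun x hx => hsep x (by simp [hx]) b (by simp) (hb x hx))
      have h3 : 0 ≤ Real.sin b := Real.sin_nonneg_of_nonneg_of_le_pi (by linarith) (by linarith)
      have : Real.pi / σ * (Real.cos lo - Real.cos a) =
        Real.pi / σ * (Real.cos lo - Real.cos b) + Real.pi / σ * (Real.cos b - Real.cos a) := by ring
      linarith

/-- At least two `σ`-separated angles whose cosines lie in a window of length `η` have a small sum
of sines: consecutive angles `x < y` satisfy `sin x + sin y ≤ (π / σ) (cos x - cos y)`, and the
right-hand sides telescope. -/
lemma sum_sin_le_of_separated (P : Finset ℝ) {σ η : ℝ} (hσ : 0 < σ)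
    (h0 : ∀ x ∈ P, 0 ≤ x) (hpi : ∀ x ∈ P, x ≤ Real.pi)
    (hsep : ∀ x ∈ P, ∀ y ∈ P, x < y → x + σ ≤ y) (hcard : 2 ≤ P.card)
    (hη : ∀ x ∈ P, ∀ y ∈ P, Real.cos x - Real.cos y ≤ η) :
    ∑ x ∈ P, Real.sin x ≤ Real.pi / σ * η := by
  have hne : P.Nonempty := Finset.card_pos.1 (by omega)
  set b := P.max' hne
  set lo := P.min' hne
  have hb : b ∈ P := P.max'_mem hne
  have hl : lo ∈ P := P.min'_mem hne
  rw [← Finset.sum_erase_add _ _ hb]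
  refine (sum_sin_add_sin_le (P.erase b) (h0 _ hl) hσ
    (fun x hx => P.min'_le _ (Finset.mem_of_mem_erase hx))
    (fun x hx y hy => hsep x (Finset.mem_of_mem_erase hx) y (Finset.mem_of_mem_erase hy))
    (Finset.card_pos.1 ?_) (hpi _ hb) ?_).trans ?_
  · rw [Finset.card_erase_of_mem hb]; omega
  · intro x hx
    have hx' := Finset.mem_of_mem_erase hx
    exact hsep x hx' b hb (lt_of_le_of_ne (P.le_max' _ hx') (Finset.ne_of_mem_erase hx))
  · have := Real.pi_pos
    gcongr
    exact hη _ hl _ hb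

/-! ### The spectral decomposition of the path -/

/-- The solution of the eigenvalue recursion `x q_j = q_{j-1} + q_{j+1}` of the path with `q_0 = 1`
and `q_{-1} = 0`; these are rescaled Chebyshev polynomials of the second kind. -/
noncomputable def pathPoly (x : ℝ) : ℕ → ℝ
  | 0 => 1
  | 1 => x
  | (j + 2) => x * pathPoly x (j + 1) - pathPoly x j

lemma pathPoly_mul_sin (θ : ℝ) (j : ℕ) :
    pathPoly (2 * Real.cos θ) j * Real.sin θ = Real.sin ((j + 1) * θ) := by
  induction j using Nat.twoStepInduction with
  | zero => simp [pathPoly]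
  | one =>
    simp only [pathPoly, Nat.cast_one]
    rw [show (1 + 1 : ℝ) * θ = 2 * θ by ring, Real.sin_two_mul]; ring
  | more j ih1 ih2 =>
    rw [pathPoly, sub_mul, mul_assoc, ih1, ih2]
    push_cast
    rw [show ((j : ℝ) + 2 + 1) * θ = (j + 1 + 1) * θ + θ by ring,
      show ((j : ℝ) + 1) * θ = (j + 1 + 1) * θ - θ by ring, Real.sin_add, Real.sin_sub]
    ring

lemma succ_le_abs_pathPoly {x : ℝ} (hx : 2 ≤ |x|) (j : ℕ) :
    (j + 1 : ℝ) ≤ |pathPoly x j| := by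
  have aux : ∀ j : ℕ, (j + 1 : ℝ) ≤ |pathPoly x j| ∧
      |pathPoly x j| + 1 ≤ |pathPoly x (j + 1)| := by
    intro j
    induction j with
    | zero => simp only [pathPoly]; norm_num; linarith
    | succ j ih =>
      refine ⟨by push_cast; linarith [ih.1, ih.2], ?_⟩
      rw [pathPoly]
      have h1 := abs_sub_abs_le_abs_sub (x * pathPoly x (j + 1)) (pathPoly x j)
      rw [abs_mul] at h1
      have h2 : 2 * |pathPoly x (j + 1)| ≤ |x| * |pathPoly x (j + 1)| := by gcongr
      linarith [ih.2]
  exact (aux j).1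

lemma sum_pathPoly_sq_pos (x : ℝ) (d : ℕ) :
    0 < ∑ j ∈ Finset.range (d + 1), pathPoly x j ^ 2 := by
  rw [Finset.sum_range_succ']
  have : 0 ≤ ∑ k ∈ Finset.range d, pathPoly x (k + 1) ^ 2 :=
    Finset.sum_nonneg fun _ _ => sq_nonneg _
  simp only [pathPoly]
  linarith

/-- The Hamiltonian of the path with sites `0, …, d` and the potential `s √2` at the last site. -/
noncomputable def pathMatrix (d : ℕ) (s : ℝ) : Matrix (Fin (d + 1)) (Fin (d + 1)) ℝ :=
  fun i j => (if (j : ℕ) = i + 1 then 1 else 0) + (if (i : ℕ) = j + 1 then 1 else 0) +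
    (if (j : ℕ) = i ∧ (i : ℕ) = d then s * √2 else 0)

lemma pathMatrix_isHermitian (d : ℕ) (s : ℝ) : (pathMatrix d s).IsHermitian := by
  ext i j
  simp only [Matrix.conjTranspose_apply, pathMatrix, star_trivial]
  rw [add_comm (if (i : ℕ) = j + 1 then (1 : ℝ) else 0)]
  congr 1
  refine if_congr ?_ rfl rfl
  constructor <;> rintro ⟨h1, h2⟩ <;> omega

lemma pathMatrix_mulVec (d : ℕ) (s : ℝ) (v : ℕ → ℝ) (i : Fin (d + 1)) :
    (pathMatrix d s).mulVec (fun j => v j) i =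
      (if (i : ℕ) < d then v (i + 1) else 0) + (if (i : ℕ) = 0 then 0 else v (i - 1)) +
        (if (i : ℕ) = d then s * √2 * v d else 0) := by
  simp only [Matrix.mulVec, dotProduct, pathMatrix]
  rw [Fin.sum_univ_eq_sum_range (fun j => ((if j = (i : ℕ) + 1 then (1 : ℝ) else 0) +
    (if (i : ℕ) = j + 1 then 1 else 0) + (if j = i ∧ (i : ℕ) = d then s * √2 else 0)) * v j)]
  simp only [add_mul, Finset.sum_add_distrib, ite_mul, one_mul, zero_mul]
  congr 1
  · congr 1
    · rw [Finset.sum_ite_eq']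
      simp
    · split_ifs with h
      · exact Finset.sum_eq_zero fun j _ => if_neg (by omega)
      · rw [Finset.sum_eq_single_of_mem ((i : ℕ) - 1) (by have := i.2; simp only [Finset.mem_range]; omega)
          (fun j _ hj => if_neg (by omega)), if_pos (by omega)]
  · split_ifs with h
    · rw [Finset.sum_eq_single_of_mem d (by simp) (fun j _ hj => if_neg (by omega)),
        if_pos (by omega)]
    · exact Finset.sum_eq_zero fun j _ => if_neg (by tauto)

/-- Eigenvectors satisfy the recursion of `pathPoly`. -/
lemma eq_mul_pathPoly_of_mulVec {d : ℕ} {s x : ℝ} {v : ℕ → ℝ}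
    (h : (pathMatrix d s).mulVec (fun j => v j) = fun i : Fin (d + 1) => x * v i) {j : ℕ} (hj : j ≤ d) :
    v j = v 0 * pathPoly x j := by
  induction j using Nat.twoStepInduction with
  | zero => simp [pathPoly]
  | one =>
    have := congrFun h ⟨0, by omega⟩
    rw [pathMatrix_mulVec] at this
    simp only [if_pos (show 0 < d by omega), if_neg (show ¬ 0 = d by omega)] at this
    simp only [pathPoly]
    simp at this
    linarith
  | more j ih1 ih2 =>
    have := congrFun h ⟨j + 1, by omega⟩
    rw [pathMatrix_mulVec] at this
    simp only [if_pos (show j + 1 < d by omega), if_neg (show ¬ j + 1 = d by omega),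
      if_neg (Nat.succ_ne_zero j), Nat.add_sub_cancel, ih1 (by omega), ih2 (by omega)] at this
    rw [pathPoly]
    linarith

/-- The last row of the eigenvalue equation is the boundary condition for the eigenvalue. -/
lemma pathPoly_boundary {d : ℕ} (hd : 1 ≤ d) {s x : ℝ} {v : ℕ → ℝ}
    (h : (pathMatrix d s).mulVec (fun j => v j) = fun i : Fin (d + 1) => x * v i) (h0 : v 0 ≠ 0) :
    pathPoly x (d + 1) = s * √2 * pathPoly x d := by
  obtain ⟨e, rfl⟩ : ∃ e, d = e + 1 := ⟨d - 1, by omega⟩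
  have := congrFun h ⟨e + 1, by omega⟩
  rw [pathMatrix_mulVec] at this
  simp only [lt_irrefl, if_false, if_true, Nat.succ_ne_zero, Nat.add_sub_cancel,
    eq_mul_pathPoly_of_mulVec h (show e ≤ e + 1 by omega),
    eq_mul_pathPoly_of_mulVec h (show e + 1 ≤ e + 1 by omega)] at this
  rw [pathPoly]
  apply mul_left_cancel₀ h0
  linarith

/-- Gauss quadrature for the path: `x` lists its eigenvalues, which are simple, and `p` their
spectral weights at the site `0`. The eigenvector for `x i` is `j ↦ pathPoly (x i) j`, and the
last property says that the unit vector at `0` is `∑ i, p i • pathPoly (x i)`. -/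
structure IsPathSpectrum (d : ℕ) (s : ℝ) (x p : Fin (d + 1) → ℝ) : Prop where
  injective : Function.Injective x
  boundary : ∀ i, pathPoly (x i) (d + 1) = s * √2 * pathPoly (x i) d
  normalized : ∀ i, p i * ∑ j ∈ Finset.range (d + 1), pathPoly (x i) j ^ 2 = 1
  complete : ∀ j ≤ d, ∑ i, p i * pathPoly (x i) j = if j = 0 then 1 else 0

lemma exists_isPathSpectrum {d : ℕ} (hd : 1 ≤ d) (s : ℝ) :
    ∃ x p, IsPathSpectrum d s x p := by
  set hM := pathMatrix_isHermitian d s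
  set b := hM.eigenvectorBasis
  set x := hM.eigenvalues
  let v : Fin (d + 1) → ℕ → ℝ := fun i j => if h : j < d + 1 then b i ⟨j, h⟩ else 0
  have hv : ∀ i (j : Fin (d + 1)), v i j = b i j := fun i j => dif_pos j.2
  have hev : ∀ i, (pathMatrix d s).mulVec (fun j => v i j) = fun j : Fin (d + 1) => x i * v i j := by
    intro i
    have := hM.mulVec_eigenvectorBasis i
    simp only [hv]
    ext j
    simpa using congrFun this j
  have hvq : ∀ i (j : Fin (d + 1)), b i j = v i 0 * pathPoly (x i) j := fun i j => by
    rw [← hv, eq_mul_pathPoly_of_mulVec (hev i) (by omega)]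
  have hinner : ∀ i k, ∑ j, b i j * b k j = if i = k then 1 else 0 := by
    intro i k
    have := orthonormal_iff_ite.1 b.orthonormal k i
    rw [PiLp.inner_apply] at this
    simp only [RCLike.inner_apply, conj_trivial] at this
    rw [this]
    exact if_congr eq_comm rfl rfl
  have hnorm : ∀ i, v i 0 ^ 2 * ∑ j ∈ Finset.range (d + 1), pathPoly (x i) j ^ 2 = 1 := by
    intro i
    have := hinner i i
    rw [if_pos rfl] at this
    rw [← this, ← Fin.sum_univ_eq_sum_range (fun j => pathPoly (x i) j ^ 2), Finset.mul_sum]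
    refine Finset.sum_congr rfl fun j _ => ?_
    rw [hvq]; ring
  have hv0 : ∀ i, v i 0 ≠ 0 := by
    intro i h
    have := hnorm i
    rw [h] at this
    simp at this
  refine ⟨x, fun i => v i 0 ^ 2, ?_, fun i => pathPoly_boundary hd (hev i) (hv0 i), hnorm, ?_⟩
  · intro i k hik
    by_contra hne
    have := hinner i k
    rw [if_neg hne] at this
    simp only [hvq, ← hik] at this
    have h2 : v i 0 * v k 0 * ∑ j ∈ Finset.range (d + 1), pathPoly (x i) j ^ 2 = 0 := by
      rw [← this, ← Fin.sum_univ_eq_sum_range (fun j => pathPoly (x i) j ^ 2), Finset.mul_sum]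
      exact Finset.sum_congr rfl fun j _ => by ring
    have h3 := (sum_pathPoly_sq_pos (x i) d).ne'
    simp [hv0, h3] at h2
  · intro j hj
    have hU := hM.eigenvectorUnitary.2
    have h1 := (Matrix.mem_unitaryGroup_iff.1 hU)
    have h2 := congrFun (congrFun h1 ⟨j, by omega⟩) ⟨0, by omega⟩
    rw [Matrix.mul_apply, Matrix.one_apply] at h2
    simp only [Matrix.star_apply, Matrix.IsHermitian.eigenvectorUnitary_apply, star_trivial] at h2
    have h3 : ∀ i, v i 0 ^ 2 * pathPoly (x i) j = b i ⟨j, by omega⟩ * b i ⟨0, by omega⟩ := by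
      intro i
      rw [hvq i ⟨j, _⟩, ← hv i ⟨0, _⟩]
      ring
    simp only [h3]
    rw [h2]
    simp [Fin.ext_iff]

namespace IsPathSpectrum

variable {d : ℕ} {s : ℝ} {x p : Fin (d + 1) → ℝ}

lemma weight_pos (h : IsPathSpectrum d s x p) (i : Fin (d + 1)) : 0 < p i :=
  pos_of_mul_pos_left (by rw [h.normalized i]; exact one_pos) (sum_pathPoly_sq_pos _ _).le

lemma sum_weight (h : IsPathSpectrum d s x p) : ∑ i, p i = 1 := by
  simpa [pathPoly] using h.complete 0 (Nat.zero_le d)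

/-- Eigenvalues outside `(-2, 2)` have negligible weight, since there `|pathPoly x j| ≥ j + 1`. -/
lemma weight_le_of_two_le (h : IsPathSpectrum d s x p) {i : Fin (d + 1)} (hi : 2 ≤ |x i|) :
    p i ≤ 3 / (d + 1 : ℝ) ^ 3 := by
  have h1 : ∀ n : ℕ, (n : ℝ) ^ 3 ≤ 3 * ∑ j ∈ Finset.range n, ((j : ℝ) + 1) ^ 2 := by
    intro n
    induction n with
    | zero => simp
    | succ n ih => rw [Finset.sum_range_succ]; push_cast; nlinarith [Nat.cast_nonneg (α := ℝ) n]
  have h2 : ∑ j ∈ Finset.range (d + 1), ((j : ℝ) + 1) ^ 2 ≤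
      ∑ j ∈ Finset.range (d + 1), pathPoly (x i) j ^ 2 := by
    refine Finset.sum_le_sum fun j _ => ?_
    rw [← sq_abs (pathPoly _ _)]
    gcongr
    exact succ_le_abs_pathPoly hi j
  have h3 := h1 (d + 1)
  push_cast at h3
  rw [le_div_iff₀ (by positivity)]
  calc p i * ((d : ℝ) + 1) ^ 3 ≤ p i * (3 * ∑ j ∈ Finset.range (d + 1), pathPoly (x i) j ^ 2) := by
        have := (h.weight_pos i).le
        gcongr; linarith
    _ = 3 * (p i * ∑ j ∈ Finset.range (d + 1), pathPoly (x i) j ^ 2) := by ring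
    _ = 3 := by rw [h.normalized i, mul_one]

/-- An eigenvalue in `(-2, 2)` is `2 cos θ` for a root angle `θ`. -/
lemma isRootAngle (h : IsPathSpectrum d s x p) (hs : s ^ 2 = 1) {i : Fin (d + 1)}
    (hi : |x i| < 2) :
    2 * Real.cos (Real.arccos (x i / 2)) = x i ∧
      IsRootAngle (d + 1) s (Real.arccos (x i / 2)) := by
  obtain ⟨h1, h2⟩ := abs_lt.1 hi
  have hc : 2 * Real.cos (Real.arccos (x i / 2)) = x i := by
    rw [Real.cos_arccos (by linarith) (by linarith)]; ring
  refine ⟨hc, hs, Real.arccos_pos.2 (by linarith), ?_, ?_⟩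
  · refine lt_of_le_of_ne (Real.arccos_le_pi _) fun e => ?_
    rw [Real.arccos_eq_pi] at e
    linarith
  · have h3 := pathPoly_mul_sin (Real.arccos (x i / 2)) (d + 1)
    have h4 := pathPoly_mul_sin (Real.arccos (x i / 2)) d
    rw [hc] at h3 h4
    rw [← h3, h.boundary]
    push_cast
    rw [← h4]; ring

lemma weight_le_sin_sq (h : IsPathSpectrum d s x p) {i : Fin (d + 1)} {θ : ℝ}
    (hc : 2 * Real.cos θ = x i) (hθ : IsRootAngle (d + 1) s θ) (hd : 2 ≤ d) :
    p i / 2 ≤ Real.sin θ ^ 2 / (d - 1.5) := by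
  have h1 := hθ.sum_sin_sq_lower
  have h2 : ∑ j ∈ Finset.range (d + 1), Real.sin ((j + 1) * θ) ^ 2 =
      Real.sin θ ^ 2 * ∑ j ∈ Finset.range (d + 1), pathPoly (x i) j ^ 2 := by
    rw [Finset.mul_sum]
    refine Finset.sum_congr rfl fun j _ => ?_
    rw [← pathPoly_mul_sin, hc]; ring
  have hd' : (2 : ℝ) ≤ d := by exact_mod_cast hd
  have hp := h.weight_pos i
  push_cast at h1
  rw [h2] at h1
  rw [le_div_iff₀ (by linarith)]
  calc p i / 2 * (d - 1.5) = p i * (((d : ℝ) + 1) / 2 - 1.25) := by ring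
    _ ≤ p i * (Real.sin θ ^ 2 * ∑ j ∈ Finset.range (d + 1), pathPoly (x i) j ^ 2) := by gcongr
    _ = Real.sin θ ^ 2 * (p i * ∑ j ∈ Finset.range (d + 1), pathPoly (x i) j ^ 2) := by ring
    _ = _ := by rw [h.normalized i, mul_one]

end IsPathSpectrum

/-! ### Column-constant eigenvectors of the glued trees -/

namespace GluedVertex

variable {d : ℕ}

lemma eq_of_val_eq {u v : GluedVertex d} (h1 : u.side = v.side) (h2 : (u.depth : ℕ) = v.depth)
    (h3 : (u.pos : ℕ) = v.pos) : u = v := by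
  obtain ⟨s, j, q⟩ := u
  obtain ⟨s', j', q'⟩ := v
  obtain rfl : s = s' := h1
  obtain rfl : j = j' := Fin.ext h2
  obtain rfl : q = q' := Fin.ext h3
  rfl

end GluedVertex

section

variable {d : ℕ}

lemma sum_ite_pair {V : Type*} [Fintype V] [DecidableEq V] {P : V → Prop} [DecidablePred P]
    (F : V → ℝ) {u₁ u₂ : V} (hne : u₁ ≠ u₂) (hP : ∀ u, P u ↔ u = u₁ ∨ u = u₂) :
    ∑ u, (if P u then F u else 0) = F u₁ + F u₂ := by
  rw [← Finset.sum_filter, ← Finset.sum_pair hne]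
  congr 1
  ext u
  simp [hP]

open Classical in
lemma sum_children (v : GluedVertex d) (F : Bool → ℕ → ℝ) :
    ∑ u : GluedVertex d, (if v.IsParent u then F u.side u.depth else 0) =
      if (v.depth : ℕ) < d then 2 * F v.side (v.depth + 1) else 0 := by
  split_ifs with h
  · have hp := v.pos.2
    have hpow : 2 ^ ((v.depth : ℕ) + 1) = 2 * 2 ^ (v.depth : ℕ) := pow_succ' _ _
    rw [sum_ite_pair (fun u : GluedVertex d => F u.side u.depth)
      (u₁ := ⟨v.side, ⟨v.depth + 1, by omega⟩, ⟨2 * v.pos, by simp only; omega⟩⟩)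
      (u₂ := ⟨v.side, ⟨v.depth + 1, by omega⟩, ⟨2 * v.pos + 1, by simp only; omega⟩⟩)]
    · ring
    · simp
    · intro u
      constructor
      · rintro ⟨h1, h2, h3⟩
        rcases Nat.even_or_odd' (u.pos : ℕ) with ⟨c, hc | hc⟩
        · exact Or.inl (GluedVertex.eq_of_val_eq h1.symm h2.symm (by simp only; omega))
        · exact Or.inr (GluedVertex.eq_of_val_eq h1.symm h2.symm (by simp only; omega))
      · rintro (rfl | rfl)
        · exact ⟨rfl, rfl, by simp only; omega⟩
        · exact ⟨rfl, rfl, by simp only; omega⟩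
  · refine Finset.sum_eq_zero fun u _ => if_neg ?_
    rintro ⟨-, h2, -⟩
    have := u.depth.2
    omega

open Classical in
lemma sum_parent (v : GluedVertex d) (F : Bool → ℕ → ℝ) :
    ∑ u : GluedVertex d, (if u.IsParent v then F u.side u.depth else 0) =
      if (v.depth : ℕ) = 0 then 0 else F v.side (v.depth - 1) := by
  split_ifs with h
  · refine Finset.sum_eq_zero fun u _ => if_neg ?_
    rintro ⟨-, h2, -⟩
    omega
  · have hp := v.pos.2
    have hpow : 2 ^ (v.depth : ℕ) = 2 * 2 ^ ((v.depth : ℕ) - 1) := by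
      rw [← pow_succ']; congr 1; omega
    let w : GluedVertex d := ⟨v.side, ⟨v.depth - 1, by omega⟩, ⟨v.pos / 2, by simp only; omega⟩⟩
    have hw : ∀ u : GluedVertex d, u.IsParent v ↔ u = w := by
      intro u
      constructor
      · rintro ⟨h1, h2, h3⟩
        exact GluedVertex.eq_of_val_eq h1 (by simp only [w]; omega) h3
      · rintro rfl
        exact ⟨rfl, by simp only [w]; omega, rfl⟩
    simp only [hw]
    rw [Finset.sum_ite_eq']
    simp [w]

lemma fin_one_ne_zero (hd : 1 ≤ d) : (1 : Fin (2 ^ d)) ≠ 0 := by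
  intro h
  have h1 := congrArg Fin.val h
  have h2 : 2 ≤ 2 ^ d := by
    calc 2 = 2 ^ 1 := rfl
      _ ≤ _ := Nat.pow_le_pow_right (by norm_num) hd
  rw [Fin.val_one', Nat.mod_eq_of_lt (by omega)] at h1
  simp at h1

open Classical in
lemma sum_cycle_left (hd : 1 ≤ d) (a b : Equiv.Perm (Fin (2 ^ d))) (v : GluedVertex d)
    (F : Bool → ℕ → ℝ) :
    ∑ u : GluedVertex d, (if GluedVertex.IsCycleEdge a b v u then F u.side u.depth else 0) =
      if v.side = false ∧ (v.depth : ℕ) = d then 2 * F true d else 0 := by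
  split_ifs with h
  · obtain ⟨hs, hj⟩ := h
    have hp : (v.pos : ℕ) < 2 ^ d := v.pos.2.trans_eq (by rw [hj])
    set i₀ := a.symm ⟨v.pos, hp⟩
    have hi₀ : (v.pos : ℕ) = a i₀ := by simp [i₀]
    rw [sum_ite_pair (fun u : GluedVertex d => F u.side u.depth)
      (u₁ := ⟨true, ⟨d, by omega⟩, b i₀⟩) (u₂ := ⟨true, ⟨d, by omega⟩, b (i₀ - 1)⟩)]
    · ring
    · simp [eq_sub_iff_add_eq, fin_one_ne_zero hd]
    · intro u
      constructor
      · rintro ⟨-, h2, -, h4, i, h5 | h5, h6⟩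
        · obtain rfl : i = i₀ := a.injective (Fin.ext (h5.symm.trans hi₀))
          exact Or.inl (GluedVertex.eq_of_val_eq h2 h4 h6)
        · have : i + 1 = i₀ := a.injective (Fin.ext (h5.symm.trans hi₀))
          obtain rfl : i = i₀ - 1 := eq_sub_of_add_eq this
          exact Or.inr (GluedVertex.eq_of_val_eq h2 h4 h6)
      · rintro (rfl | rfl)
        · exact ⟨hs, rfl, hj, rfl, i₀, Or.inl hi₀, rfl⟩
        · exact ⟨hs, rfl, hj, rfl, i₀ - 1, Or.inr (by rw [sub_add_cancel]; exact hi₀), rfl⟩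
  · exact Finset.sum_eq_zero fun u _ => if_neg fun hc => h ⟨hc.1, hc.2.2.1⟩

open Classical in
lemma sum_cycle_right (hd : 1 ≤ d) (a b : Equiv.Perm (Fin (2 ^ d))) (v : GluedVertex d)
    (F : Bool → ℕ → ℝ) :
    ∑ u : GluedVertex d, (if GluedVertex.IsCycleEdge a b u v then F u.side u.depth else 0) =
      if v.side = true ∧ (v.depth : ℕ) = d then 2 * F false d else 0 := by
  split_ifs with h
  · obtain ⟨hs, hj⟩ := h
    have hp : (v.pos : ℕ) < 2 ^ d := v.pos.2.trans_eq (by rw [hj])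
    set i₀ := b.symm ⟨v.pos, hp⟩
    have hi₀ : (v.pos : ℕ) = b i₀ := by simp [i₀]
    rw [sum_ite_pair (fun u : GluedVertex d => F u.side u.depth)
      (u₁ := ⟨false, ⟨d, by omega⟩, a i₀⟩) (u₂ := ⟨false, ⟨d, by omega⟩, a (i₀ + 1)⟩)]
    · ring
    · simp [fin_one_ne_zero hd]
    · intro u
      constructor
      · rintro ⟨h1, -, h3, -, i, h5, h6⟩
        obtain rfl : i = i₀ := b.injective (Fin.ext (h6.symm.trans hi₀))
        rcases h5 with h5 | h5
        · exact Or.inl (GluedVertex.eq_of_val_eq h1 h3 h5)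
        · exact Or.inr (GluedVertex.eq_of_val_eq h1 h3 h5)
      · rintro (rfl | rfl)
        · exact ⟨rfl, hs, rfl, hj, i₀, Or.inl rfl, hi₀⟩
        · exact ⟨rfl, hs, rfl, hj, i₀, Or.inr rfl, hi₀⟩
  · exact Finset.sum_eq_zero fun u _ => if_neg fun hc => h ⟨hc.2.1, hc.2.2.2.1⟩

open Classical in
/-- The neighbours of a vertex: two children or, for a leaf, two leaves of the other tree, and the
parent unless the vertex is a root. -/
lemma sum_neighbors (hd : 1 ≤ d) (a b : Equiv.Perm (Fin (2 ^ d))) (v : GluedVertex d)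
    (F : Bool → ℕ → ℝ) :
    ∑ u : GluedVertex d, (if (gluedTrees a b).Adj v u then F u.side u.depth else 0) =
      (if (v.depth : ℕ) < d then 2 * F v.side (v.depth + 1) else 0) +
      (if (v.depth : ℕ) = 0 then 0 else F v.side (v.depth - 1)) +
      (if (v.depth : ℕ) = d then 2 * F (!v.side) d else 0) := by
  have hsplit : ∀ u : GluedVertex d, (if (gluedTrees a b).Adj v u then F u.side u.depth else 0) =
      (if v.IsParent u then F u.side u.depth else 0) +
      (if u.IsParent v then F u.side u.depth else 0) +
      ((if GluedVertex.IsCycleEdge a b v u then F u.side u.depth else 0) +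
      (if GluedVertex.IsCycleEdge a b u v then F u.side u.depth else 0)) := by
    intro u
    have hadj : (gluedTrees a b).Adj v u ↔ v ≠ u ∧ ((v.IsParent u ∨ GluedVertex.IsCycleEdge a b v u)
        ∨ (u.IsParent v ∨ GluedVertex.IsCycleEdge a b u v)) := SimpleGraph.fromRel_adj _ _ _
    by_cases h1 : v.IsParent u
    · have h2 : ¬ u.IsParent v := fun h => by have := h.2.1; have := h1.2.1; omega
      have h3 : ¬ GluedVertex.IsCycleEdge a b v u := fun h => by
        have := h.1; have := h.2.1; have := h1.1; simp_all
      have h4 : ¬ GluedVertex.IsCycleEdge a b u v := fun h => by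
        have := h.1; have := h.2.1; have := h1.1; simp_all
      have h5 : v ≠ u := by rintro rfl; have := h1.2.1; omega
      simp [hadj, h1, h2, h3, h4, h5]
    by_cases h2 : u.IsParent v
    · have h3 : ¬ GluedVertex.IsCycleEdge a b v u := fun h => by
        have := h.1; have := h.2.1; have := h2.1; simp_all
      have h4 : ¬ GluedVertex.IsCycleEdge a b u v := fun h => by
        have := h.1; have := h.2.1; have := h2.1; simp_all
      have h5 : v ≠ u := by rintro rfl; have := h2.2.1; omega
      simp [hadj, h1, h2, h3, h4, h5]
    by_cases h3 : GluedVertex.IsCycleEdge a b v u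
    · have h4 : ¬ GluedVertex.IsCycleEdge a b u v := fun h => by
        have := h.1; have := h3.2.1; simp_all
      have h5 : v ≠ u := by rintro rfl; have := h3.1; have := h3.2.1; simp_all
      simp [hadj, h1, h2, h3, h4, h5]
    by_cases h4 : GluedVertex.IsCycleEdge a b u v
    · have h5 : v ≠ u := by rintro rfl; have := h4.1; have := h4.2.1; simp_all
      simp [hadj, h1, h2, h3, h4, h5]
    · simp [hadj, h1, h2, h3, h4]
  simp only [hsplit, Finset.sum_add_distrib]
  rw [sum_children, sum_parent, sum_cycle_left hd, sum_cycle_right hd]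
  congr 1
  cases h : v.side <;> simp

/-- The value at depth `j` of the tree `side` of the column-constant vector which is
`pathPoly x` in the normalized column states of the first tree, and `s` times its mirror image in
the second tree. -/
noncomputable def columnValue (s x : ℝ) (side : Bool) (j : ℕ) : ℝ :=
  (if side then s else 1) * pathPoly x j / √2 ^ j

/-- At a leaf the boundary condition makes the two leaves of the other tree look like the missing
children. -/
lemma columnValue_eigen {s x : ℝ} (hs : s ^ 2 = 1)
    (hb : pathPoly x (d + 1) = s * √2 * pathPoly x d) (side : Bool) {j : ℕ} (hj : j ≤ d) :
    1 / √2 * ((if j < d then 2 * columnValue s x side (j + 1) else 0) +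
      (if j = 0 then 0 else columnValue s x side (j - 1)) +
      (if j = d then 2 * columnValue s x (!side) d else 0)) = x * columnValue s x side j := by
  have h2 : √2 ^ 2 = (2 : ℝ) := Real.sq_sqrt (by norm_num)
  have h0 : √2 ≠ (0 : ℝ) := by positivity
  -- beyond the leaves, `q_{d+1}` stands for the two leaves of the other tree
  have hnext : (if j < d then 2 * columnValue s x side (j + 1) else 0) +
      (if j = d then 2 * columnValue s x (!side) d else 0) =
      2 * columnValue s x side (j + 1) := by
    rcases hj.lt_or_eq with h | rfl
    · rw [if_pos h, if_neg h.ne, add_zero]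
    · rw [if_neg (lt_irrefl _), if_pos rfl, zero_add]
      simp only [columnValue]
      rw [hb]
      cases side
      · simp [pow_succ]; field_simp
      · simp [pow_succ]; field_simp; linear_combination -pathPoly x j * hs
  have hassoc : ∀ y z w : ℝ, y + z + w = (y + w) + z := fun y z w => by ring
  rw [hassoc, hnext]
  have hpow : ∀ i : ℕ, √2 ^ (i + 2) = 2 * √2 ^ i := fun i => by rw [pow_add, h2]; ring
  cases j with
  | zero =>
    simp only [columnValue, pathPoly, if_true, pow_zero, zero_add, pow_one]
    field_simp
    rw [h2]; ring
  | succ i =>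
    simp only [columnValue, pathPoly, Nat.succ_ne_zero, if_false, Nat.add_sub_cancel, pow_succ]
    field_simp
    simp only [h2]
    ring

lemma hamiltonian_mulVec (hd : 1 ≤ d) (a b : Equiv.Perm (Fin (2 ^ d))) {s x : ℝ} (hs : s ^ 2 = 1)
    (hb : pathPoly x (d + 1) = s * √2 * pathPoly x d) :
    (gluedTreesHamiltonian a b).mulVec (fun v => (columnValue s x v.side v.depth : ℂ)) =
      (x : ℂ) • fun v => (columnValue s x v.side v.depth : ℂ) := by
  classical
  ext v
  have key := columnValue_eigen hs hb v.side (Nat.lt_succ_iff.1 v.depth.2)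
  rw [← sum_neighbors hd a b v (columnValue s x)] at key
  rw [gluedTreesHamiltonian, Matrix.smul_mulVec, Pi.smul_apply, Pi.smul_apply, smul_eq_mul,
    smul_eq_mul, ← Complex.ofReal_mul, ← key, Complex.ofReal_mul]
  congr 1
  simp only [Matrix.mulVec, dotProduct, SimpleGraph.adjMatrix_apply, Complex.ofReal_sum]
  refine Finset.sum_congr rfl fun u _ => ?_
  split_ifs <;> simp

end

/-! ### The transition amplitude -/

lemma exp_smul_mulVec_of_eigen {V : Type*} [Fintype V] [DecidableEq V] {H : Matrix V V ℂ}
    {X : V → ℂ} {μ : ℂ} (h : H.mulVec X = μ • X) (z : ℂ) :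
    (NormedSpace.exp (z • H)).mulVec X = Complex.exp (z * μ) • X := by
  open scoped Matrix.Norms.Operator in
  have h1 := NormedSpace.exp_series_hasSum_exp' (𝕂 := ℂ) (z • H)
  have hpow : ∀ n : ℕ, ((z • H) ^ n).mulVec X = (z * μ) ^ n • X := by
    intro n
    induction n with
    | zero => simp
    | succ n ih =>
      rw [pow_succ, ← Matrix.mulVec_mulVec, Matrix.smul_mulVec, h, smul_smul, Matrix.mulVec_smul,
        ih, smul_smul, pow_succ, mul_comm]
  have h2 := h1.map (Matrix.mulVecBilin ℂ ℂ |>.flip X) (by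
    show Continuous fun A : Matrix V V ℂ => A.mulVec X
    fun_prop)
  have h3 := (NormedSpace.exp_series_hasSum_exp' (𝕂 := ℂ) (z * μ)).smul_const X
  rw [Complex.exp_eq_exp_ℂ]
  refine HasSum.unique h2 ?_
  convert h3 using 2 with n
  simp [hpow, smul_smul]

/-- The amplitude from the entrance to the exit is a trigonometric sum: the entrance is the
combination of the column-constant eigenvectors with coefficients `p / 2`, and these take the
value `s` at the exit. -/
lemma walkProb_exit {d : ℕ} (hd : 1 ≤ d) (a b : Equiv.Perm (Fin (2 ^ d)))
    {x p : Bool → Fin (d + 1) → ℝ} {s : Bool → ℝ} (hs0 : s false = 1) (hs1 : s true = -1)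
    (h : ∀ σ, IsPathSpectrum d (s σ) (x σ) (p σ)) (t : ℝ) :
    walkProb (gluedTreesHamiltonian a b) (Pi.single GluedVertex.entrance 1) GluedVertex.exit t =
      ‖∑ σ : Bool × Fin (d + 1), ((s σ.1 * p σ.1 σ.2 / 2 : ℝ) : ℂ) *
        Complex.exp (-(Complex.I * t) * x σ.1 σ.2)‖ ^ 2 := by
  have hψ : (Pi.single GluedVertex.entrance 1 : GluedVertex d → ℂ) =
      ∑ σ : Bool × Fin (d + 1), ((p σ.1 σ.2 / 2 : ℝ) : ℂ) •
        fun v : GluedVertex d => (columnValue (s σ.1) (x σ.1 σ.2) v.side v.depth : ℂ) := by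
    ext v
    have hcol : ∀ σ, ∑ i, p σ i / 2 * columnValue (s σ) (x σ i) v.side v.depth =
        if (v.depth : ℕ) = 0 then (if v.side then s σ else 1) / 2 else 0 := by
      intro σ
      have h1 := (h σ).complete v.depth (Nat.lt_succ_iff.1 v.depth.2)
      calc _ = (if v.side then s σ else 1) / (2 * √2 ^ (v.depth : ℕ)) *
            ∑ i, p σ i * pathPoly (x σ i) v.depth := by
            rw [Finset.mul_sum]
            refine Finset.sum_congr rfl fun i _ => ?_
            rw [columnValue]; field_simp
        _ = _ := by
            rw [h1]
            by_cases h2 : (v.depth : ℕ) = 0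
            · rw [if_pos h2, if_pos h2, h2]; ring
            · simp [h2]
    have hreal : ∑ σ : Bool × Fin (d + 1), p σ.1 σ.2 / 2 *
        columnValue (s σ.1) (x σ.1 σ.2) v.side v.depth =
        if v = GluedVertex.entrance then 1 else 0 := by
      rw [Fintype.sum_prod_type, Fintype.sum_bool, hcol, hcol, hs0, hs1]
      by_cases hv : v = GluedVertex.entrance
      · subst hv
        simp [GluedVertex.entrance]
        norm_num
      · rw [if_neg hv]
        by_cases h0 : (v.depth : ℕ) = 0
        · have hside : v.side = true := by
            by_contra hside
            refine hv (GluedVertex.eq_of_val_eq (Bool.eq_false_of_not_eq_true hside) h0 ?_)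
            have h3 : (v.pos : ℕ) < 2 ^ 0 := v.pos.2.trans_eq (by rw [h0])
            simp only [GluedVertex.entrance]
            omega
          simp [h0, hside]
          norm_num
        · simp [h0]
    rw [Finset.sum_apply, Pi.single_apply]
    simp only [Pi.smul_apply, smul_eq_mul, ← Complex.ofReal_mul]
    rw [← Complex.ofReal_sum, hreal]
    split_ifs <;> simp
  rw [walkProb, hψ, Matrix.mulVec_sum, Finset.sum_apply]
  congr 2
  refine Finset.sum_congr rfl fun σ _ => ?_
  have hs : s σ.1 ^ 2 = 1 := by rcases σ with ⟨_ | _, i⟩ <;> simp [hs0, hs1]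
  rw [Matrix.mulVec_smul, exp_smul_mulVec_of_eigen (hamiltonian_mulVec hd a b hs
    ((h σ.1).boundary σ.2))]
  simp [GluedVertex.exit, columnValue, pathPoly]
  ring

/-! ### Sums of uniform times -/

lemma isProbabilityMeasure_cond_Icc {T : ℝ} (hT : 0 < T) :
    IsProbabilityMeasure (ProbabilityTheory.cond volume (Set.Icc 0 T)) :=
  ProbabilityTheory.cond_isProbabilityMeasure_of_finite (by simp [hT]) (by simp)

lemma norm_charFun_uniform_le {T s : ℝ} (hT : 0 < T) (hs : s ≠ 0) :
    ‖charFun (ProbabilityTheory.cond volume (Set.Icc 0 T)) s‖ ≤ 2 / (T * |s|) := by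
  have hc : (s * Complex.I : ℂ) ≠ 0 := by simp [hs]
  have h1 : charFun (ProbabilityTheory.cond volume (Set.Icc 0 T)) s =
      (T⁻¹ : ℝ) • ((Complex.exp (s * Complex.I * T) - Complex.exp (s * Complex.I * (0 : ℝ))) /
        (s * Complex.I)) := by
    rw [← integral_exp_mul_complex hc, charFun_apply_real, ProbabilityTheory.cond,
      integral_smul_measure, intervalIntegral.integral_of_le hT.le, integral_Icc_eq_integral_Ioc]
    congr 1
    · simp [hT.le]
    · refine integral_congr_ae (ae_of_all _ fun x => ?_)
      simp only
      congr 1; ring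
  have h2 : ‖Complex.exp (s * Complex.I * T) - Complex.exp (s * Complex.I * (0 : ℝ))‖ ≤ 2 := by
    refine (norm_sub_le _ _).trans ?_
    have : ∀ u : ℝ, ‖Complex.exp (s * Complex.I * u)‖ = 1 := fun u => by
      rw [show (s * Complex.I * u : ℂ) = ((s * u : ℝ) : ℂ) * Complex.I by push_cast; ring]
      exact Complex.norm_exp_ofReal_mul_I _
    rw [this, this]; norm_num
  rw [h1, norm_smul, norm_div, Real.norm_of_nonneg (by positivity)]
  have h3 : ‖(s * Complex.I : ℂ)‖ = |s| := by simp
  rw [h3]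
  have : 0 < |s| := abs_pos.2 hs
  calc _ ≤ T⁻¹ * (2 / |s|) := by gcongr
    _ = _ := by field_simp

lemma isProbabilityMeasure_sumUniformLaw {T : ℝ} (hT : 0 < T) (k : ℕ) :
    IsProbabilityMeasure (sumUniformLaw T k) := by
  have := isProbabilityMeasure_cond_Icc hT
  exact Measure.isProbabilityMeasure_map (by fun_prop)

lemma norm_charFun_sumUniformLaw_le {T s : ℝ} (hT : 0 < T) (hs : s ≠ 0) (k : ℕ) :
    ‖charFun (sumUniformLaw T k) s‖ ≤ (2 / (T * |s|)) ^ k := by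
  have := isProbabilityMeasure_cond_Icc hT
  rw [sumUniformLaw, ProbabilityTheory.charFun_map_sum_pi_eq_prod
    (fun _ : Fin k => ProbabilityTheory.cond volume (Set.Icc 0 T))]
  simp only [Finset.prod_const, Finset.card_univ, Fintype.card_fin, Pi.pow_apply, norm_pow]
  gcongr
  exact norm_charFun_uniform_le hT hs

lemma sumUniformLaw_ae_le {T : ℝ} (hT : 0 < T) (k : ℕ) :
    ∀ᵐ t ∂(sumUniformLaw T k), t ≤ k * T := by
  have := isProbabilityMeasure_cond_Icc hT
  rw [sumUniformLaw, ae_map_iff (by fun_prop) measurableSet_Iic]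
  have h : ∀ᵐ t ∂(Measure.pi fun _ : Fin k => ProbabilityTheory.cond volume (Set.Icc 0 T)),
      ∀ j, t j ≤ T := by
    refine ae_all_iff.2 fun j => ?_
    have h1 : ∀ᵐ x ∂(ProbabilityTheory.cond volume (Set.Icc 0 T)), x ≤ T := by
      filter_upwards [ProbabilityTheory.ae_cond_mem (μ := (volume : Measure ℝ))
        (measurableSet_Icc (a := 0) (b := T))] with x hx using hx.2
    exact (measurePreserving_eval
      (fun _ : Fin k => ProbabilityTheory.cond volume (Set.Icc 0 T)) j).quasiMeasurePreserving.ae h1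
  filter_upwards [h] with t ht
  calc ∑ j, t j ≤ ∑ _j : Fin k, T := Finset.sum_le_sum fun j _ => ht j
    _ = k * T := by simp

/-! ### The mean square of a trigonometric sum -/

section TrigSum

variable {ι : Type*} [Fintype ι] (μ : Measure ℝ) [IsProbabilityMeasure μ] (a x : ι → ℝ)

lemma normSq_trigSum (t : ℝ) :
    ((‖∑ i, (a i : ℂ) * Complex.exp (-(Complex.I * t) * x i)‖ ^ 2 : ℝ) : ℂ) =
      ∑ i, ∑ j, (a i * a j : ℂ) * Complex.exp (((x j - x i : ℝ) : ℂ) * t * Complex.I) := by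
  rw [← Complex.normSq_eq_norm_sq, ← Complex.mul_conj, map_sum, Finset.sum_mul_sum]
  refine Finset.sum_congr rfl fun i _ => Finset.sum_congr rfl fun j _ => ?_
  rw [map_mul, ← Complex.exp_conj, Complex.conj_ofReal]
  simp only [map_mul, map_neg, Complex.conj_I, Complex.conj_ofReal]
  rw [mul_mul_mul_comm, ← Complex.exp_add]
  congr 2
  push_cast; ring

lemma integrable_exp_ofReal_mul_I (s : ℝ) :
    Integrable (fun t : ℝ => Complex.exp ((s : ℂ) * t * Complex.I)) μ := by
  refine Integrable.of_bound (C := 1) (by fun_prop) (ae_of_all _ fun t => ?_)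
  rw [← Complex.ofReal_mul, Complex.norm_exp_ofReal_mul_I]

lemma integral_normSq_trigSum :
    ((∫ t, ‖∑ i, (a i : ℂ) * Complex.exp (-(Complex.I * t) * x i)‖ ^ 2 ∂μ : ℝ) : ℂ) =
      ∑ i, ∑ j, (a i * a j : ℂ) * charFun μ (x j - x i) := by
  rw [← integral_complex_ofReal]
  simp only [normSq_trigSum]
  have hint : ∀ i j, Integrable (fun t : ℝ => (a i * a j : ℂ) *
      Complex.exp (((x j - x i : ℝ) : ℂ) * t * Complex.I)) μ :=
    fun i j => (integrable_exp_ofReal_mul_I μ _).const_mul _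
  rw [integral_finsetSum _ fun i _ => integrable_finsetSum _ fun j _ => hint i j]
  refine Finset.sum_congr rfl fun i _ => ?_
  rw [integral_finsetSum _ fun j _ => hint i j]
  refine Finset.sum_congr rfl fun j _ => ?_
  rw [integral_const_mul, charFun_apply_real]

/-- The mean square of a trigonometric sum is at least its diagonal part minus the sum of the
cross terms, each damped by the characteristic function at the frequency difference. -/
lemma sum_sq_sub_le_integral [DecidableEq ι] :
    ∑ i, a i ^ 2 - ∑ i, |a i| * ∑ j ∈ Finset.univ.erase i, |a j| * ‖charFun μ (x j - x i)‖ ≤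
      ∫ t, ‖∑ i, (a i : ℂ) * Complex.exp (-(Complex.I * t) * x i)‖ ^ 2 ∂μ := by
  have h := congrArg Complex.re (integral_normSq_trigSum μ a x)
  rw [Complex.ofReal_re] at h
  rw [h, Complex.re_sum, ← Finset.sum_sub_distrib]
  refine Finset.sum_le_sum fun i _ => ?_
  rw [Complex.re_sum, ← Finset.add_sum_erase _ _ (Finset.mem_univ i), Finset.mul_sum, sub_eq_add_neg,
    ← Finset.sum_neg_distrib]
  refine add_le_add ?_ (Finset.sum_le_sum fun j _ => ?_)
  · rw [sub_self, charFun_zero]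
    simp only [probReal_univ, Complex.ofReal_one, mul_one]
    rw [← Complex.ofReal_mul, Complex.ofReal_re, sq]
  · rw [← mul_assoc, ← abs_mul]
    refine le_trans (neg_le_neg ?_) (neg_abs_le _)
    refine (Complex.abs_re_le_norm _).trans_eq ?_
    rw [norm_mul, ← Complex.ofReal_mul, Complex.norm_real, Real.norm_eq_abs]

end TrigSum

/-! ### Independent rounds -/

section Rounds

variable {V : Type*} [Fintype V] [DecidableEq V] {H : Matrix V V ℂ} {ψ : V → ℂ}

lemma continuous_walkProb (H : Matrix V V ℂ) (ψ : V → ℂ) (y : V) :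
    Continuous (walkProb H ψ y) := by
  have h : Continuous fun t : ℝ => NormedSpace.exp ((-(Complex.I * (t : ℂ))) • H) := by
    open scoped Matrix.Norms.Operator in
    exact NormedSpace.exp_continuous.comp (by fun_prop)
  unfold walkProb
  fun_prop

lemma sum_walkProb (hH : H.IsHermitian) (hψ : ∑ v, ‖ψ v‖ ^ 2 = 1) (t : ℝ) :
    ∑ v, walkProb H ψ v t = 1 := by
  set U := NormedSpace.exp ((-(Complex.I * (t : ℂ))) • H) with hU
  have hunit : U.conjTranspose * U = 1 := by
    have h1 : ((-(Complex.I * (t : ℂ))) • H).conjTranspose = -((-(Complex.I * (t : ℂ))) • H) := by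
      rw [Matrix.conjTranspose_smul, hH.eq]
      simp
    rw [hU, ← Matrix.exp_conjTranspose, h1, ← Matrix.exp_add_of_commute]
    · simp
    · exact (Commute.refl _).neg_left
  have hnorm : ∀ φ : V → ℂ, ((∑ v, ‖φ v‖ ^ 2 : ℝ) : ℂ) = star φ ⬝ᵥ φ := by
    intro φ
    rw [dotProduct, Complex.ofReal_sum]
    refine Finset.sum_congr rfl fun v _ => ?_
    rw [Pi.star_apply, ← Complex.normSq_eq_norm_sq, Complex.normSq_eq_conj_mul_self]
    rfl
  have : ((∑ v, walkProb H ψ v t : ℝ) : ℂ) = 1 := by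
    simp only [walkProb]
    rw [hnorm, Matrix.star_mulVec, ← Matrix.dotProduct_mulVec, Matrix.mulVec_mulVec, hunit,
      Matrix.one_mulVec, ← hnorm, hψ, Complex.ofReal_one]
  exact_mod_cast this

lemma walkProb_nonneg (y : V) (t : ℝ) : 0 ≤ walkProb H ψ y t := by
  unfold walkProb; positivity

lemma meanProb_eq_ofReal (hH : H.IsHermitian) (hψ : ∑ v, ‖ψ v‖ ^ 2 = 1) {T : ℝ} (hT : 0 < T)
    (k : ℕ) (y : V) :
    meanProb H ψ y T k = ENNReal.ofReal (∫ t, walkProb H ψ y t ∂(sumUniformLaw T k)) := by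
  have := isProbabilityMeasure_sumUniformLaw hT k
  rw [meanProb, ofReal_integral_eq_lintegral_ofReal]
  · refine Integrable.of_bound (C := 1) (continuous_walkProb H ψ y).aestronglyMeasurable
      (ae_of_all _ fun t => ?_)
    rw [Real.norm_of_nonneg (walkProb_nonneg y t), ← sum_walkProb hH hψ t]
    exact Finset.single_le_sum (f := fun v => walkProb H ψ v t)
      (fun v _ => walkProb_nonneg v t) (Finset.mem_univ y)
  · exact ae_of_all _ fun t => walkProb_nonneg y t

variable [MeasurableSpace V]

/-- The measured vertex is discrete, so a round is a finite sum over the outcomes. -/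
lemma roundLaw_apply (H : Matrix V V ℂ) (ψ : V → ℂ) (T : ℝ) (k : ℕ) {S : Set (ℝ × V)}
    (hS : MeasurableSet S) :
    roundLaw H ψ T k S = ∑ v, ∫⁻ t in {t | (t, v) ∈ S}, ENNReal.ofReal (walkProb H ψ v t)
      ∂(sumUniformLaw T k) := by
  rw [roundLaw, Measure.finsetSum_apply]
  refine Finset.sum_congr rfl fun v _ => ?_
  have hm : Measurable fun t : ℝ => (t, v) := by fun_prop
  rw [Measure.map_apply hm hS, withDensity_apply _ (hm hS)]
  rfl

lemma isProbabilityMeasure_roundLaw (hH : H.IsHermitian) (hψ : ∑ v, ‖ψ v‖ ^ 2 = 1) {T : ℝ}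
    (hT : 0 < T) (k : ℕ) : IsProbabilityMeasure (roundLaw H ψ T k) := by
  have := isProbabilityMeasure_sumUniformLaw hT k
  constructor
  rw [roundLaw_apply H ψ T k MeasurableSet.univ]
  simp only [Set.mem_univ, Set.ofPred_true, Measure.restrict_univ]
  rw [← lintegral_finsetSum _ fun v _ =>
    (continuous_walkProb H ψ v).measurable.ennreal_ofReal]
  simp only [← ENNReal.ofReal_sum_of_nonneg fun v _ => walkProb_nonneg v _, sum_walkProb hH hψ]
  simp

lemma roundLaw_snd_eq [MeasurableSingletonClass V] (H : Matrix V V ℂ) (ψ : V → ℂ) (T : ℝ) (k : ℕ)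
    (y : V) : roundLaw H ψ T k {p | p.2 = y} = meanProb H ψ y T k := by
  have hm : MeasurableSet {p : ℝ × V | p.2 = y} := measurable_snd (measurableSet_singleton y)
  rw [roundLaw_apply H ψ T k hm, Finset.sum_eq_single_of_mem y (Finset.mem_univ y)]
  · simp [meanProb]
  · intro v _ hv
    simp [hv]

lemma roundLaw_ae_le (H : Matrix V V ℂ) (ψ : V → ℂ) {T : ℝ} (hT : 0 < T) (k : ℕ) :
    ∀ᵐ p ∂(roundLaw H ψ T k), p.1 ≤ k * T := by
  have hm : MeasurableSet {p : ℝ × V | p.1 ≤ k * T} := measurable_fst measurableSet_Iic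
  rw [ae_iff, show {p : ℝ × V | ¬ p.1 ≤ k * T} = {p | p.1 ≤ k * T}ᶜ from rfl,
    roundLaw_apply H ψ T k hm.compl]
  refine Finset.sum_eq_zero fun v _ => setLIntegral_measure_zero _ _ ?_
  exact sumUniformLaw_ae_le hT k

lemma repeatedWalkLaw_ae_sum_le (hH : H.IsHermitian) (hψ : ∑ v, ‖ψ v‖ ^ 2 = 1) {T : ℝ}
    (hT : 0 < T) (k R : ℕ) :
    ∀ᵐ ω ∂(repeatedWalkLaw H ψ T k R), ∑ i, (ω i).1 ≤ R * (k * T) := by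
  have := isProbabilityMeasure_roundLaw hH hψ hT k
  have h : ∀ᵐ ω ∂(repeatedWalkLaw H ψ T k R), ∀ i, (ω i).1 ≤ k * T :=
    ae_all_iff.2 fun i => (measurePreserving_eval
      (fun _ : Fin R => roundLaw H ψ T k) i).quasiMeasurePreserving.ae (roundLaw_ae_le H ψ hT k)
  filter_upwards [h] with ω hω
  calc ∑ i, (ω i).1 ≤ ∑ _i : Fin R, k * T := Finset.sum_le_sum fun i _ => hω i
    _ = _ := by simp

lemma repeatedWalkLaw_success [MeasurableSingletonClass V] (hH : H.IsHermitian)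
    (hψ : ∑ v, ‖ψ v‖ ^ 2 = 1) {T : ℝ} (hT : 0 < T) (k R : ℕ) (y : V) :
    repeatedWalkLaw H ψ T k R {ω | ∃ i, (ω i).2 = y} = 1 - (1 - meanProb H ψ y T k) ^ R := by
  have := isProbabilityMeasure_roundLaw hH hψ hT k
  have hm : MeasurableSet {p : ℝ × V | p.2 = y} := measurable_snd (measurableSet_singleton y)
  have hset : {ω : Fin R → ℝ × V | ∃ i, (ω i).2 = y} =
      (Set.univ.pi fun _ => {p : ℝ × V | p.2 = y}ᶜ)ᶜ := by
    ext ω; simp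
  rw [hset, repeatedWalkLaw, prob_compl_eq_one_sub (MeasurableSet.univ_pi fun _ => hm.compl),
    Measure.pi_pi]
  simp only [prob_compl_eq_one_sub hm, roundLaw_snd_eq, Finset.prod_const, Finset.card_univ,
    Fintype.card_fin]

end Rounds

/-! ### Weights of nearby eigenvalues -/

/-- Roots of opposite signs whose cosines nearly coincide lie near `0` or `π`. With `D = θ' - θ` and
`S = sin ((θ + θ') / 2)`, repulsion gives `|D| ≳ 2√2 S / (3m)`, and then the distance
`2 S sin (|D| / 2)` of the cosines is of order `S² / m`, so that `S² ≤ 0.034`. -/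
lemma IsRootAngle.sin_sq_le_of_near {m : ℕ} {s θ θ' : ℝ} {n : ℝ} (h : IsRootAngle m s θ)
    (h' : IsRootAngle m (-s) θ') (hn : 100000 ≤ n) (hmn : (m : ℝ) ≤ n + 1)
    (hnm : n ≤ m) (hnear : |2 * Real.cos θ' - 2 * Real.cos θ| < 1 / (16 * n)) :
    Real.sin θ' ^ 2 ≤ 0.136 := by
  have hn0 : 0 < n := by linarith
  set S := Real.sin ((θ' + θ) / 2) with hS
  set e := |θ' - θ| / 2 with he
  have hpi := Real.pi_lt_d2
  have he0 : 0 ≤ e := by positivity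
  have hepi : e ≤ Real.pi / 2 := by
    have : |θ' - θ| ≤ Real.pi := abs_le.2 ⟨by linarith [h.pos, h'.pos, h.lt_pi, h'.lt_pi],
      by linarith [h.pos, h'.pos, h.lt_pi, h'.lt_pi]⟩
    linarith
  have hS0 : 0 < S := Real.sin_pos_of_pos_of_lt_pi (by linarith [h.pos, h'.pos])
    (by linarith [h.lt_pi, h'.lt_pi])
  have hcosabs : Real.cos ((θ' - θ) / 2) = Real.cos e := by
    rw [← Real.cos_abs, abs_div, abs_two]
  have hsin0 : 0 ≤ Real.sin e := Real.sin_nonneg_of_nonneg_of_le_pi he0 (by linarith)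
  have hsinabs : |Real.sin ((θ' - θ) / 2)| = Real.sin e := by
    rw [← abs_of_nonneg hsin0, he]
    rcases abs_cases (θ' - θ) with ⟨h1, -⟩ | ⟨h1, -⟩ <;> rw [h1]
    rw [neg_div, Real.sin_neg, abs_neg]
  have hadd : Real.sin θ' + Real.sin θ = 2 * S * Real.cos e := by
    rw [Real.sin_add_sin, hcosabs]
  have hprod : 2 * S * Real.sin e < 1 / (32 * n) := by
    have h1 : |2 * Real.cos θ' - 2 * Real.cos θ| = 4 * (S * Real.sin e) := by
      rw [← mul_sub, Real.cos_sub_cos, ← hsinabs]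
      simp only [abs_mul, abs_neg, abs_two, abs_of_pos hS0, ← hS]
      ring
    rw [h1] at hnear
    have : 1 / (16 * n) = 2 * (1 / (32 * n)) := by field_simp; norm_num
    linarith
  have hSe : Real.sin e ≤ S := by
    have h1 : 0 < Real.sin θ' * Real.sin θ := mul_pos h'.sin_pos h.sin_pos
    have h2 : Real.sin θ' = S * Real.cos ((θ' - θ) / 2) +
        Real.cos ((θ' + θ) / 2) * Real.sin ((θ' - θ) / 2) := by
      rw [hS, ← Real.sin_add]; ring_nf
    have h3 : Real.sin θ = S * Real.cos ((θ' - θ) / 2) -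
        Real.cos ((θ' + θ) / 2) * Real.sin ((θ' - θ) / 2) := by
      rw [hS, ← Real.sin_sub]; ring_nf
    have h4 := Real.sin_sq_add_cos_sq ((θ' + θ) / 2)
    have h5 := Real.sin_sq_add_cos_sq ((θ' - θ) / 2)
    have h6 : Real.sin θ' * Real.sin θ = S ^ 2 - Real.sin ((θ' - θ) / 2) ^ 2 := by
      rw [h2, h3]
      linear_combination S ^ 2 * h5 - Real.sin ((θ' - θ) / 2) ^ 2 * h4
    rw [← sq_abs (Real.sin ((θ' - θ) / 2)), hsinabs] at h6
    exact (abs_le_of_sq_le_sq' (by linarith) hS0.le).2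
  have hn32 : 1 / (32 * n) ≤ 0.00000032 := by
    rw [div_le_iff₀ (by linarith)]; linarith
  have hsinsmall : Real.sin e ≤ 0.0004 := by
    by_contra! hc
    nlinarith
  have hesmall : e ≤ 0.001 := by
    have h1 := Real.mul_le_sin he0 hepi
    have h2 : (0.6 : ℝ) ≤ 2 / Real.pi := by
      rw [le_div_iff₀ Real.pi_pos]; linarith
    nlinarith
  have hcos : 0.999 ≤ Real.cos e := by
    have := Real.one_sub_sq_div_two_le_cos (x := e)
    nlinarith
  have hsinlow : 0.999 * e ≤ Real.sin e := by
    rcases he0.eq_or_lt with h1 | h1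
    · rw [← h1]; simp
    · have := Real.sin_gt_sub_cube h1
      nlinarith [mul_pos h1 h1]
  have hrep := h.repulsion h'
  rw [add_comm (Real.sin θ), hadd, show |θ' - θ| = 2 * e by rw [he]; ring] at hrep
  have h2l : (1.414 : ℝ) ≤ √2 := Real.le_sqrt_of_sq_le (by norm_num)
  have h2u : √2 ≤ 1.415 := Real.sqrt_le_iff.2 ⟨by norm_num, by norm_num⟩
  have hm : (100000 : ℝ) ≤ m := by linarith
  have h1 : 1.414 * (2 * S * 0.999) ≤ m * e * 6.01 := by
    calc 1.414 * (2 * S * 0.999) ≤ √2 * (2 * S * Real.cos e) := by gcongr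
      _ ≤ _ := hrep
      _ ≤ m * e * 0.001 + m * (2 * e) * (3 + 1.415 * (2 * 0.001)) := by
        have h0 : 2 * e ≤ m * e * 0.001 := by nlinarith
        exact add_le_add h0 (by gcongr)
      _ ≤ _ := by nlinarith [mul_nonneg (show (0 : ℝ) ≤ m by linarith) he0]
  have h3 : 0.469 * S ≤ m * e := by linarith
  have h4 : 32 * n * (2 * S * (0.999 * e)) < 1 := by
    have h5 : 2 * S * (0.999 * e) < 1 / (32 * n) :=
      lt_of_le_of_lt (by gcongr) hprod
    rw [lt_div_iff₀ (by linarith)] at h5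
    linarith
  have h5 : S ^ 2 ≤ 0.034 := by
    by_contra! hc
    have h6 : (m : ℝ) * (32 * n * (2 * S * (0.999 * e))) < m * 1 := by gcongr
    have h7 : n * (S * (0.469 * S)) ≤ n * (S * (m * e)) := by gcongr
    have h8 : n * 0.034 ≤ n * S ^ 2 := by gcongr
    nlinarith
  have h6 : Real.sin θ' ≤ 2 * S := by
    have := h.sin_pos
    have : 2 * S * Real.cos e ≤ 2 * S * 1 := by gcongr; exact Real.cos_le_one _
    linarith
  have := h'.sin_pos
  nlinarith

namespace IsPathSpectrum

variable {d : ℕ} {s : ℝ} {x p : Fin (d + 1) → ℝ}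

/-- At least two eigenvalues of the same sign in a window of length `2 δ`: each `p i / 2` is at most
`sin² θ / (d - 1.5)`, and the sines have a small sum because the angles are separated. -/
lemma sum_weight_window (h : IsPathSpectrum d s x p) (hs : s ^ 2 = 1) (hd : 30 ≤ d) {δ : ℝ}
    (I : Finset (Fin (d + 1))) (hI : ∀ i ∈ I, |x i| < 2) (hcard : 2 ≤ I.card)
    (hδ : ∀ i ∈ I, ∀ j ∈ I, x i - x j ≤ 2 * δ) :
    ∑ i ∈ I, p i / 2 ≤ (Real.pi / (1.5 / (d + 1)) * δ) ^ 2 / (d - 1.5) := by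
  set θ : Fin (d + 1) → ℝ := fun i => Real.arccos (x i / 2)
  have hroot : ∀ i ∈ I, 2 * Real.cos (θ i) = x i ∧ IsRootAngle (d + 1) s (θ i) :=
    fun i hi => h.isRootAngle hs (hI i hi)
  have hinj : Set.InjOn θ I := by
    intro i hi j hj hij
    apply h.injective
    rw [← (hroot i hi).1, ← (hroot j hj).1, hij]
  have hd' : (30 : ℝ) ≤ d := by exact_mod_cast hd
  have key := sum_sin_le_of_separated (I.image θ) (σ := 1.5 / (d + 1)) (η := δ) (by positivity)
    (by simp only [Finset.forall_mem_image]; exact fun i hi => (hroot i hi).2.pos.le)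
    (by simp only [Finset.forall_mem_image]; exact fun i hi => (hroot i hi).2.lt_pi.le)
    (by
      simp only [Finset.forall_mem_image]
      intro i hi j hj hij
      have := (hroot i hi).2.separated (by omega) (hroot j hj).2 hij.ne
      rw [abs_of_pos (by linarith)] at this
      push_cast at this
      linarith)
    (by rwa [Finset.card_image_of_injOn hinj])
    (by
      simp only [Finset.forall_mem_image]
      intro i hi j hj
      have := hδ i hi j hj
      rw [← (hroot i hi).1, ← (hroot j hj).1] at this
      linarith)
  rw [Finset.sum_image hinj] at key
  have hsin : ∀ i ∈ I, 0 ≤ Real.sin (θ i) := fun i hi => (hroot i hi).2.sin_pos.le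
  calc ∑ i ∈ I, p i / 2 ≤ ∑ i ∈ I, Real.sin (θ i) ^ 2 / (d - 1.5) :=
        Finset.sum_le_sum fun i hi =>
          h.weight_le_sin_sq (hroot i hi).1 (hroot i hi).2 (by omega)
    _ = (∑ i ∈ I, Real.sin (θ i) ^ 2) / (d - 1.5) := by rw [Finset.sum_div]
    _ ≤ (∑ i ∈ I, Real.sin (θ i)) ^ 2 / (d - 1.5) := by
        have : (0 : ℝ) ≤ d - 1.5 := by linarith
        gcongr
        exact Finset.sum_sq_le_sq_sum_of_nonneg hsin
    _ ≤ _ := by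
        have : (0 : ℝ) ≤ d - 1.5 := by linarith
        have : 0 ≤ ∑ i ∈ I, Real.sin (θ i) := Finset.sum_nonneg hsin
        gcongr

lemma sum_weight_outside (h : IsPathSpectrum d s x p) :
    ∑ i with ¬ |x i| < 2, p i / 2 ≤ 1.5 / (d + 1 : ℝ) ^ 2 := by
  calc ∑ i with ¬ |x i| < 2, p i / 2 ≤ ∑ i with ¬ |x i| < 2, 1.5 / (d + 1 : ℝ) ^ 3 := by
        refine Finset.sum_le_sum fun i hi => ?_
        have := h.weight_le_of_two_le (not_lt.1 (Finset.mem_filter.1 hi).2)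
        calc p i / 2 ≤ (3 / (d + 1 : ℝ) ^ 3) / 2 := by gcongr
          _ = _ := by ring
    _ ≤ ∑ _i : Fin (d + 1), 1.5 / (d + 1 : ℝ) ^ 3 :=
        Finset.sum_le_sum_of_subset_of_nonneg (Finset.filter_subset _ _)
          fun _ _ _ => by positivity
    _ = _ := by
        simp only [Finset.sum_const, Finset.card_univ, Fintype.card_fin, nsmul_eq_mul]
        push_cast
        field_simp

/-- The bound for a window of length `2 δ = 1 / (8 n)`. -/
lemma window_bound {n D : ℝ} (hn : 100000 ≤ n) (hDn : n ≤ D + 1) (hnD : D ≤ n) :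
    (Real.pi / (1.5 / (D + 1)) * (1 / (16 * n))) ^ 2 / (D - 1.5) ≤ 0.02 / n := by
  have hpi := Real.pi_lt_d2
  have hpi0 := Real.pi_pos
  have h1 : Real.pi / (1.5 / (D + 1)) * (1 / (16 * n)) ≤ 0.132 := by
    have : Real.pi / (1.5 / (D + 1)) * (1 / (16 * n)) = Real.pi * (D + 1) / (24 * n) := by
      field_simp; ring
    rw [this, div_le_iff₀ (by linarith)]
    nlinarith
  have h0 : 0 ≤ Real.pi / (1.5 / (D + 1)) * (1 / (16 * n)) := by
    have : 0 ≤ D + 1 := by linarith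
    positivity
  rw [div_le_div_iff₀ (by linarith) (by linarith)]
  have h2 : (Real.pi / (1.5 / (D + 1)) * (1 / (16 * n))) ^ 2 ≤ 0.132 ^ 2 := by gcongr
  nlinarith

/-- The other eigenvalues of the same sign near a given one have little weight. -/
lemma sum_weight_near_same (h : IsPathSpectrum d s x p) (hs : s ^ 2 = 1) {n : ℝ}
    (hn : 100000 ≤ n) (hdn : n ≤ d + 1) (hnd : d ≤ n) {i : Fin (d + 1)} (hi : |x i| < 2) :
    ∑ j with j ≠ i ∧ |x j| < 2 ∧ |x j - x i| < 1 / (16 * n), p j / 2 ≤ 0.02 / n := by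
  have hd : (99999 : ℝ) ≤ d := by linarith
  have hd' : 30 ≤ d := by
    have : (30 : ℝ) ≤ d := by linarith
    exact_mod_cast this
  set I := Finset.univ.filter fun j => j ≠ i ∧ |x j| < 2 ∧ |x j - x i| < 1 / (16 * n)
  -- together with `i` itself, a nonempty `I` has at least two elements
  rcases I.eq_empty_or_nonempty with hI | hI
  · rw [hI, Finset.sum_empty]; positivity
  have hiI : i ∉ I := by simp [I]
  have hmem : ∀ j ∈ insert i I, |x j| < 2 ∧ |x j - x i| < 1 / (16 * n) := by
    intro j hj
    rcases Finset.mem_insert.1 hj with rfl | hj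
    · refine ⟨hi, ?_⟩
      rw [sub_self, abs_zero]; positivity
    · exact (Finset.mem_filter.1 hj).2.2
  have key := h.sum_weight_window hs hd' (δ := 1 / (16 * n)) (insert i I)
    (fun j hj => (hmem j hj).1)
    (by rw [Finset.card_insert_of_notMem hiI]; have := Finset.card_pos.2 hI; omega)
    (fun j hj k hk => by
      have h1 := (abs_lt.1 (hmem j hj).2).2
      have h2 := (abs_lt.1 (hmem k hk).2).1
      linarith)
  rw [Finset.sum_insert hiI] at key
  have := h.weight_pos i
  have hb : (Real.pi / (1.5 / (d + 1)) * (1 / (16 * n))) ^ 2 / (d - 1.5) ≤ 0.02 / n :=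
    window_bound hn hdn hnd
  linarith

/-- The eigenvalues of the opposite sign near a given one have moderate weight: either there are
at least two of them, which are separated, or there is a single one, whose angle is near `0` or `π`. -/
lemma sum_weight_near_opposite (h : IsPathSpectrum d (-s) x p) (hs : s ^ 2 = 1) {n : ℝ}
    (hn : 100000 ≤ n) (hdn : n ≤ d + 1) (hnd : d ≤ n) {θ : ℝ} (hθ : IsRootAngle (d + 1) s θ) :
    ∑ j with |x j| < 2 ∧ |x j - 2 * Real.cos θ| < 1 / (16 * n), p j / 2 ≤ 0.14 / n := by
  have hd : (99999 : ℝ) ≤ d := by linarith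
  have hd' : 30 ≤ d := by
    have : (30 : ℝ) ≤ d := by linarith
    exact_mod_cast this
  have hs' : (-s) ^ 2 = 1 := by rw [neg_sq, hs]
  set I := Finset.univ.filter fun j => |x j| < 2 ∧ |x j - 2 * Real.cos θ| < 1 / (16 * n)
  have hmem : ∀ j ∈ I, |x j| < 2 ∧ |x j - 2 * Real.cos θ| < 1 / (16 * n) :=
    fun j hj => (Finset.mem_filter.1 hj).2
  by_cases hcard : 2 ≤ I.card
  · have key := h.sum_weight_window hs' hd' (δ := 1 / (16 * n)) I (fun j hj => (hmem j hj).1)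
      hcard (fun j hj k hk => by
        have h1 := (abs_lt.1 (hmem j hj).2).2
        have h2 := (abs_lt.1 (hmem k hk).2).1
        linarith)
    have hb : (Real.pi / (1.5 / (d + 1)) * (1 / (16 * n))) ^ 2 / (d - 1.5) ≤ 0.02 / n :=
    window_bound hn hdn hnd
    have : 0.02 / n ≤ 0.14 / n := by gcongr; norm_num
    linarith
  · rcases Finset.card_le_one_iff_subset_singleton.1 (show I.card ≤ 1 by omega) with ⟨j, hj⟩
    rcases Finset.subset_singleton_iff.1 hj with hI | hI
    · rw [hI, Finset.sum_empty]; positivity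
    · rw [hI, Finset.sum_singleton]
      have hjI := hmem j (by rw [hI]; simp)
      obtain ⟨hc, hr⟩ := h.isRootAngle hs' hjI.1
      refine (h.weight_le_sin_sq hc hr (by omega)).trans ?_
      rw [← hc] at hjI
      have h1 := hθ.sin_sq_le_of_near hr hn (by push_cast; linarith) (by push_cast; linarith) hjI.2
      calc _ ≤ 0.136 / ((d : ℝ) - 1.5) := by
            have : (0 : ℝ) ≤ d - 1.5 := by linarith
            gcongr
        _ ≤ _ := by
            rw [div_le_div_iff₀ (by linarith) (by linarith)]
            linarith

end IsPathSpectrum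

/-! ### The mean probability of finding the exit -/

section MeanProb

variable {d : ℕ} {x p : Bool → Fin (d + 1) → ℝ} {s : Bool → ℝ} {n : ℝ}

/-- The total weight of the other eigenvalues, of either sign, within `1 / (16 n)` of a given one. -/
lemma sum_weight_near (hs0 : s false = 1) (hs1 : s true = -1)
    (h : ∀ σ, IsPathSpectrum d (s σ) (x σ) (p σ)) (hn : 100000 ≤ n) (hdn : n ≤ d + 1)
    (hnd : d ≤ n) (i : Bool × Fin (d + 1)) (hi : |x i.1 i.2| < 2) :
    ∑ j ∈ Finset.univ.erase i with |x j.1 j.2 - x i.1 i.2| < 1 / (16 * n), p j.1 j.2 / 2 ≤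
      3 / (d + 1 : ℝ) ^ 2 + 0.16 / n := by
  obtain ⟨τ, i⟩ := i
  have hs : ∀ σ, s σ ^ 2 = 1 := by intro σ; cases σ <;> simp [hs0, hs1]
  have hneg : s (!τ) = -s τ := by cases τ <;> simp [hs0, hs1]
  have hw : ∀ σ j, 0 < p σ j := fun σ j => (h σ).weight_pos j
  obtain ⟨hc, hr⟩ := (h τ).isRootAngle (hs τ) hi
  have hsame := (h τ).sum_weight_near_same (hs τ) hn hdn hnd hi
  have hopp := (hneg ▸ h (!τ)).sum_weight_near_opposite (hs τ) hn hdn hnd hr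
  rw [hc] at hopp
  have ho1 := (h τ).sum_weight_outside
  have ho2 := (h (!τ)).sum_weight_outside
  rw [Finset.sum_filter] at hsame hopp ho1 ho2
  have hsplit : ∑ j ∈ Finset.univ.erase (τ, i) with |x j.1 j.2 - x τ i| < 1 / (16 * n),
      p j.1 j.2 / 2 =
      ∑ j, (if j ≠ i ∧ |x τ j - x τ i| < 1 / (16 * n) then p τ j / 2 else 0) +
      ∑ j, (if |x (!τ) j - x τ i| < 1 / (16 * n) then p (!τ) j / 2 else 0) := by
    rw [show (Finset.univ.erase (τ, i)).filter
      (fun j : Bool × Fin (d + 1) => |x j.1 j.2 - x τ i| < 1 / (16 * n)) =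
      Finset.univ.filter (fun j => j ≠ (τ, i) ∧ |x j.1 j.2 - x τ i| < 1 / (16 * n)) by
        ext j; simp, Finset.sum_filter, Fintype.sum_prod_type, Fintype.sum_bool]
    cases τ
    · rw [add_comm]; simp
    · simp
  rw [hsplit]
  have h1 : ∑ j, (if j ≠ i ∧ |x τ j - x τ i| < 1 / (16 * n) then p τ j / 2 else 0) ≤
      1.5 / (d + 1 : ℝ) ^ 2 + 0.02 / n := by
    refine le_trans ?_ (add_le_add ho1 hsame)
    rw [← Finset.sum_add_distrib]
    refine Finset.sum_le_sum fun j _ => ?_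
    have := hw τ j
    by_cases hj : |x τ j| < 2 <;> simp only [hj] <;> split_ifs <;> first | linarith | tauto
  have h2 : ∑ j, (if |x (!τ) j - x τ i| < 1 / (16 * n) then p (!τ) j / 2 else 0) ≤
      1.5 / (d + 1 : ℝ) ^ 2 + 0.14 / n := by
    refine le_trans ?_ (add_le_add ho2 hopp)
    rw [← Finset.sum_add_distrib]
    refine Finset.sum_le_sum fun j _ => ?_
    have := hw (!τ) j
    by_cases hj : |x (!τ) j| < 2 <;> simp only [hj] <;> split_ifs <;> first | linarith | tauto
  calc _ ≤ _ := add_le_add h1 h2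
    _ = _ := by ring

/-- At frequency differences of at least `1 / (16 n)` each uniform time on `[0, 64 n]` contributes a
factor of at most `1 / 2`. -/
lemma norm_charFun_le_of_le {k : ℕ} (hn : 0 < n) (hk : 5 * n ≤ 2 ^ k) {δ : ℝ}
    (hδ : 1 / (16 * n) ≤ |δ|) : ‖charFun (sumUniformLaw (64 * n) k) δ‖ ≤ 1 / (5 * n) := by
  have hδ0 : 0 < |δ| := lt_of_lt_of_le (by positivity) hδ
  refine (norm_charFun_sumUniformLaw_le (by positivity) (abs_pos.1 hδ0) k).trans ?_
  have h1 : 2 / (64 * n * |δ|) ≤ 1 / 2 := by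
    rw [div_le_iff₀ (by positivity)] at hδ ⊢
    linarith
  calc (2 / (64 * n * |δ|)) ^ k ≤ (1 / 2) ^ k := by gcongr
    _ = 1 / 2 ^ k := by rw [div_pow, one_pow]
    _ ≤ _ := by gcongr

/-- The diagonal part of the mean probability, at least `1 / (2 (d + 1))` by Cauchy–Schwarz,
dominates the cross terms: those of eigenvalues at distance at least `1 / (16 n)` are damped by the
random time, and the nearby eigenvalues carry too little weight. -/
lemma meanProb_exit_lower {n d : ℕ} (hn : 100000 ≤ n) (hdn : d = n ∨ d + 1 = n)
    (a b : Equiv.Perm (Fin (2 ^ d))) {k : ℕ} (hk : 5 * (n : ℝ) ≤ 2 ^ k) :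
    0.1 / (n : ℝ) ≤ ∫ t, walkProb (gluedTreesHamiltonian a b) (Pi.single GluedVertex.entrance 1)
      GluedVertex.exit t ∂(sumUniformLaw (64 * n) k) := by
  have hn' : (100000 : ℝ) ≤ n := by exact_mod_cast hn
  have hdn1 : (n : ℝ) ≤ d + 1 := by
    have : n ≤ d + 1 := by omega
    exact_mod_cast this
  have hnd : (d : ℝ) ≤ n := by
    have : d ≤ n := by omega
    exact_mod_cast this
  have hn0 : (0 : ℝ) < n := by linarith
  have hprob := isProbabilityMeasure_sumUniformLaw (T := 64 * (n : ℝ)) (by positivity) k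
  let s : Bool → ℝ := fun σ => if σ then -1 else 1
  have hs0 : s false = 1 := by simp [s]
  have hs1 : s true = -1 := by simp [s]
  have hex : ∀ σ, ∃ x p, IsPathSpectrum d (s σ) x p :=
    fun σ => exists_isPathSpectrum (by omega) (s σ)
  choose x p h using hex
  simp only [walkProb_exit (by omega) a b hs0 hs1 h]
  refine le_trans ?_ (sum_sq_sub_le_integral _ (fun σ : Bool × Fin (d + 1) =>
    s σ.1 * p σ.1 σ.2 / 2) (fun σ => x σ.1 σ.2))
  set w : Bool × Fin (d + 1) → ℝ := fun σ => p σ.1 σ.2 / 2 with hw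
  have hw0 : ∀ i, 0 ≤ w i := fun i => by have := (h i.1).weight_pos i.2; simp only [hw]; positivity
  have habs : ∀ i : Bool × Fin (d + 1), |s i.1 * p i.1 i.2 / 2| = w i := by
    intro i
    have h1 : |s i.1| = 1 := by rcases i with ⟨_ | _, j⟩ <;> simp [s]
    rw [mul_div_assoc, abs_mul, h1, one_mul, abs_of_nonneg (hw0 i)]
  have hsum : ∑ i, w i = 1 := by
    rw [Fintype.sum_prod_type, Fintype.sum_bool]
    simp only [hw, ← Finset.sum_div, (h _).sum_weight]
    norm_num
  have hsq : ∀ i : Bool × Fin (d + 1), (s i.1 * p i.1 i.2 / 2) ^ 2 = w i ^ 2 := fun i => by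
    rw [← sq_abs, habs]
  simp only [habs, hsq]
  have hdiag : 1 / (2 * (d + 1 : ℝ)) ≤ ∑ i, w i ^ 2 := by
    have h1 := sq_sum_le_card_mul_sum_sq (s := Finset.univ) (f := w)
    rw [hsum, Finset.card_univ, Fintype.card_prod, Fintype.card_bool, Fintype.card_fin] at h1
    push_cast at h1
    rw [div_le_iff₀ (by positivity)]
    linarith
  set X : Bool × Fin (d + 1) → ℝ := fun σ => x σ.1 σ.2
  have hrow : ∀ i, ∑ j ∈ Finset.univ.erase i,
      w j * ‖charFun (sumUniformLaw (64 * n) k) (X j - X i)‖ ≤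
      1 / (5 * n) + ∑ j ∈ Finset.univ.erase i with |X j - X i| < 1 / (16 * n), w j := by
    intro i
    have h1 : ∑ j ∈ Finset.univ.erase i, w j * (1 / (5 * (n : ℝ))) ≤ 1 / (5 * n) := by
      rw [← Finset.sum_mul]
      have : ∑ j ∈ Finset.univ.erase i, w j ≤ 1 := by
        rw [← hsum]
        exact Finset.sum_le_sum_of_subset_of_nonneg (Finset.erase_subset _ _) fun j _ _ => hw0 j
      calc _ ≤ 1 * (1 / (5 * (n : ℝ))) := by gcongr
        _ = _ := one_mul _
    refine le_trans ?_ (add_le_add_left h1 _)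
    rw [Finset.sum_filter, ← Finset.sum_add_distrib]
    refine Finset.sum_le_sum fun j _ => ?_
    have h0 := hw0 j
    split_ifs with hj
    · have h2 : w j * ‖charFun (sumUniformLaw (64 * n) k) (X j - X i)‖ ≤ w j * 1 := by
        gcongr
        exact norm_charFun_le_one _
      have : 0 ≤ w j * (1 / (5 * (n : ℝ))) := by positivity
      linarith
    · rw [add_zero]
      gcongr
      exact norm_charFun_le_of_le hn0 hk (not_lt.1 hj)
  have hnear : ∀ i, |X i| < 2 →
      ∑ j ∈ Finset.univ.erase i with |X j - X i| < 1 / (16 * n), w j ≤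
        3 / (d + 1 : ℝ) ^ 2 + 0.16 / n :=
    fun i hi => sum_weight_near hs0 hs1 h hn' hdn1 hnd i hi
  have hout : ∑ i with ¬ |X i| < 2, w i ≤ 3 / (d + 1 : ℝ) ^ 2 := by
    rw [Finset.sum_filter, Fintype.sum_prod_type, Fintype.sum_bool]
    have h1 := (h true).sum_weight_outside
    have h2 := (h false).sum_weight_outside
    rw [Finset.sum_filter] at h1 h2
    calc _ ≤ 1.5 / (d + 1 : ℝ) ^ 2 + 1.5 / (d + 1 : ℝ) ^ 2 := add_le_add h1 h2
      _ = _ := by ring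
  have hoff : ∑ i, w i * ∑ j ∈ Finset.univ.erase i,
      w j * ‖charFun (sumUniformLaw (64 * n) k) (X j - X i)‖ ≤
      (1 / (5 * n) + (3 / (d + 1 : ℝ) ^ 2 + 0.16 / n)) + 3 / (d + 1 : ℝ) ^ 2 := by
    have hterm : ∀ i, w i * ∑ j ∈ Finset.univ.erase i,
        w j * ‖charFun (sumUniformLaw (64 * n) k) (X j - X i)‖ ≤
        w i * (1 / (5 * n) + (3 / (d + 1 : ℝ) ^ 2 + 0.16 / n)) +
          if ¬ |X i| < 2 then w i else 0 := by
      intro i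
      have h0 := hw0 i
      have h1 := hrow i
      by_cases hi : |X i| < 2
      · rw [if_neg (not_not.2 hi), add_zero]
        have := hnear i hi
        gcongr
        linarith
      · -- an eigenvalue outside `(-2, 2)` may be near any other one, but its own weight is tiny
        rw [if_pos hi]
        have h2 : ∑ j ∈ Finset.univ.erase i with |X j - X i| < 1 / (16 * n), w j ≤ 1 := by
          rw [← hsum]
          exact Finset.sum_le_sum_of_subset_of_nonneg (Finset.subset_univ _) fun j _ _ => hw0 j
        calc _ ≤ w i * (1 / (5 * n) + 1) := by gcongr; linarith
          _ = w i * (1 / (5 * n)) + w i := by ring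
          _ ≤ _ := by
            gcongr
            have : 0 ≤ 3 / (d + 1 : ℝ) ^ 2 + 0.16 / n := by positivity
            linarith
    refine (Finset.sum_le_sum fun i _ => hterm i).trans ?_
    rw [Finset.sum_add_distrib, ← Finset.sum_mul, hsum, one_mul, ← Finset.sum_filter]
    gcongr
  -- in units of `1 / n`: the diagonal is `≥ 0.499`, the cross terms are `≤ 0.2 + 0.16 + 0.002`
  have h1 : 3 / (d + 1 : ℝ) ^ 2 ≤ 0.001 / n := by
    rw [div_le_div_iff₀ (by positivity) hn0]
    nlinarith
  have h2 : 0.499 / (n : ℝ) ≤ 1 / (2 * (d + 1 : ℝ)) := by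
    rw [div_le_div_iff₀ hn0 (by positivity)]
    linarith
  have h3 : 1 / (5 * (n : ℝ)) = 0.2 / n := by field_simp; norm_num
  have h4 : 0.1 / (n : ℝ) = 0.499 / n - (0.2 / n + (0.001 / n + 0.16 / n)) - 0.001 / n
      - 0.037 / n := by ring
  have h5 : 0 ≤ 0.037 / (n : ℝ) := by positivity
  linarith

end MeanProb

/-! ### Hitting time and success probability -/

lemma gluedTreesHamiltonian_isHermitian {d : ℕ} (a b : Equiv.Perm (Fin (2 ^ d))) :
    (gluedTreesHamiltonian a b).IsHermitian := by
  classical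
  ext u v
  simp only [gluedTreesHamiltonian, Matrix.conjTranspose_apply, Matrix.smul_apply, smul_eq_mul,
    SimpleGraph.adjMatrix_apply, (gluedTrees a b).adj_comm v u, star_mul']
  rw [show star (((1 / √2 : ℝ) : ℂ)) = ((1 / √2 : ℝ) : ℂ) from Complex.conj_ofReal _]
  split_ifs <;> simp

lemma sum_norm_single_sq {V : Type*} [Fintype V] [DecidableEq V] (u : V) :
    ∑ v, ‖(Pi.single u 1 : V → ℂ) v‖ ^ 2 = 1 := by
  rw [Finset.sum_eq_single_of_mem u (Finset.mem_univ u)]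
  · simp
  · intro v _ hv
    simp [Pi.single_eq_of_ne hv]

lemma pow_ceil_logb_ge {n : ℕ} (hn : 0 < n) :
    5 * (n : ℝ) ≤ 2 ^ ⌈Real.logb 2 (5 * n)⌉₊ := by
  have h0 : (0 : ℝ) < 5 * n := by positivity
  rw [← Real.rpow_natCast, ← Real.logb_le_iff_le_rpow (by norm_num) h0]
  exact Nat.le_ceil _

lemma ceil_logb_le {n : ℕ} (hn : 100000 ≤ n) :
    (⌈Real.logb 2 (5 * n)⌉₊ : ℝ) ≤ 4 * Real.log n := by
  have hn' : (100000 : ℝ) ≤ n := by exact_mod_cast hn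
  have hlog5 : Real.log 5 ≤ Real.log n / 4 := by
    have h1 : Real.log 5 * 4 = Real.log ((5 : ℝ) ^ 4) := by rw [Real.log_pow]; push_cast; ring
    have h2 : Real.log ((5 : ℝ) ^ 4) ≤ Real.log n :=
      Real.log_le_log (by norm_num) (by norm_num; linarith)
    linarith
  have hl2 := Real.log_two_gt_d9
  have hlog1 : 1 ≤ Real.log n / 4 := by
    have h1 : (8 : ℝ) * Real.log 2 = Real.log ((2 : ℝ) ^ 8) := by rw [Real.log_pow]; push_cast; ring
    have h2 : Real.log ((2 : ℝ) ^ 8) ≤ Real.log n :=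
      Real.log_le_log (by norm_num) (by norm_num; linarith)
    linarith
  have hlogb : Real.logb 2 (5 * n) ≤ 2 * Real.log n := by
    rw [Real.logb, Real.log_mul (by norm_num) (by linarith), div_le_iff₀ (by linarith)]
    nlinarith
  have hpos : 0 ≤ Real.logb 2 (5 * n) := Real.logb_nonneg (by norm_num) (by linarith)
  have := Nat.ceil_lt_add_one hpos
  linarith

lemma isLittleO_sq_mul_log :
    (fun n : ℕ => (n : ℝ) ^ 2 * Real.log n) =o[atTop] (fun n : ℕ => (n : ℝ) ^ 5) := by
  have h1 : (fun y : ℝ => Real.log y) =o[atTop] fun y : ℝ => y ^ 3 := by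
    refine Real.isLittleO_log_id_atTop.trans_isBigO (Asymptotics.IsBigO.of_bound 1 ?_)
    filter_upwards [eventually_ge_atTop 1] with y hy
    rw [one_mul, id, Real.norm_of_nonneg (by linarith), Real.norm_of_nonneg (by positivity)]
    exact le_self_pow₀ hy (by norm_num)
  have h2 := h1.comp_tendsto tendsto_natCast_atTop_atTop
  refine ((Asymptotics.isBigO_refl (fun n : ℕ => (n : ℝ) ^ 2)
    atTop).mul_isLittleO h2).congr_right ?_
  intro n
  simp only [Function.comp]
  ring

/-- `20 n` independent trials of success probability at least `1 / (10 n)`: some trial succeeds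
with probability at least `1 - exp (-2)`. -/
lemma success_lower {n : ℕ} (hn : 1 ≤ n) {P : ℝ≥0∞} (hP : ENNReal.ofReal (0.1 / n) ≤ P) :
    ENNReal.ofReal (1 - Real.exp (-2)) ≤ 1 - (1 - P) ^ (20 * n) := by
  have hn' : (1 : ℝ) ≤ n := by exact_mod_cast hn
  have h0 : (0 : ℝ) ≤ 1 - 0.1 / n := by
    rw [sub_nonneg, div_le_iff₀ (by linarith)]; linarith
  have h1 : (1 - P) ^ (20 * n) ≤ ENNReal.ofReal (Real.exp (-2)) := by
    calc (1 - P) ^ (20 * n) ≤ (1 - ENNReal.ofReal (0.1 / n)) ^ (20 * n) := by gcongr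
      _ = ENNReal.ofReal ((1 - 0.1 / n) ^ (20 * n)) := by
        rw [← ENNReal.ofReal_one, ← ENNReal.ofReal_sub _ (by positivity), ENNReal.ofReal_pow h0]
      _ ≤ _ := by
        apply ENNReal.ofReal_le_ofReal
        calc (1 - 0.1 / (n : ℝ)) ^ (20 * n) ≤ Real.exp (-(0.1 / n)) ^ (20 * n) := by
              gcongr
              exact Real.one_sub_le_exp_neg _
          _ = Real.exp (-2) := by
              rw [← Real.exp_nat_mul]
              congr 1
              push_cast
              field_simp
              norm_num
  rw [ENNReal.ofReal_sub _ (Real.exp_pos _).le, ENNReal.ofReal_one]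
  exact tsub_le_tsub_left h1 1

theorem mainTheorem1 :
    (∃ C c : ℝ, 0 < C ∧ 0 < c ∧ ∃ N : ℕ, ∀ n : ℕ, N ≤ n →
      ∀ d : ℕ, (d = n ∨ d + 1 = n) → ∀ a b : Equiv.Perm (Fin (2 ^ d)),
        let H := gluedTreesHamiltonian a b
        let ψ : GluedVertex d → ℂ := Pi.single GluedVertex.entrance 1
        let y : GluedVertex d := GluedVertex.exit
        let T : ℝ := 64 * n
        let k : ℕ := ⌈Real.logb 2 (5 * n)⌉₊
        hittingRatio H ψ y T k ≤ ENNReal.ofReal (C * ((n : ℝ) ^ 2 * Real.log n)) ∧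
        hittingTime H ψ y k ≤ ENNReal.ofReal (C * ((n : ℝ) ^ 2 * Real.log n)) ∧
        (∀ᵐ ω ∂(repeatedWalkLaw H ψ T k (20 * n)),
          ∑ i, (ω i).1 ≤ C * ((n : ℝ) ^ 2 * Real.log n)) ∧
        ENNReal.ofReal c ≤ repeatedWalkLaw H ψ T k (20 * n) {ω | ∃ i, (ω i).2 = y}) ∧
    (fun n : ℕ => (n : ℝ) ^ 2 * Real.log n) =o[atTop] (fun n : ℕ => (n : ℝ) ^ 5) := by
  -- `5120` comes from the total time `20 n k T = 1280 n² k` of all rounds and `k ≤ 4 log n`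
  refine ⟨⟨5120, 1 - Real.exp (-2), by norm_num, ?_, 100000, ?_⟩, isLittleO_sq_mul_log⟩
  · rw [sub_pos, Real.exp_lt_one_iff]; norm_num
  intro n hn d hdn a b H ψ y T k
  have hn' : (100000 : ℝ) ≤ n := by exact_mod_cast hn
  have hn0 : (0 : ℝ) < n := by linarith
  have hT : 0 < T := by simp only [T]; positivity
  have hH : H.IsHermitian := gluedTreesHamiltonian_isHermitian a b
  have hψ : ∑ v, ‖ψ v‖ ^ 2 = 1 := sum_norm_single_sq _
  have hP : ENNReal.ofReal (0.1 / n) ≤ meanProb H ψ y T k := by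
    rw [meanProb_eq_ofReal hH hψ hT]
    exact ENNReal.ofReal_le_ofReal
      (meanProb_exit_lower hn hdn a b (pow_ceil_logb_ge (by omega)))
  have hk : (k : ℝ) ≤ 4 * Real.log n := ceil_logb_le hn
  have hratio : hittingRatio H ψ y T k ≤ ENNReal.ofReal (5120 * ((n : ℝ) ^ 2 * Real.log n)) := by
    calc hittingRatio H ψ y T k ≤ ENNReal.ofReal (k * T) / ENNReal.ofReal (0.1 / n) :=
          ENNReal.div_le_div_left hP _
      _ = ENNReal.ofReal (k * T / (0.1 / n)) :=
          (ENNReal.ofReal_div_of_pos (by positivity)).symm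
      _ ≤ _ := by
          apply ENNReal.ofReal_le_ofReal
          calc k * T / (0.1 / n) = 640 * (n : ℝ) ^ 2 * k := by
                simp only [T]; field_simp; ring
            _ ≤ 640 * (n : ℝ) ^ 2 * (4 * Real.log n) := by gcongr
            _ ≤ _ := by
                have : 0 ≤ (n : ℝ) ^ 2 * Real.log n := by
                  have := Real.log_nonneg (show (1 : ℝ) ≤ n by linarith)
                  positivity
                linarith
  refine ⟨hratio, (iInf₂_le T hT).trans hratio, ?_, ?_⟩
  · filter_upwards [repeatedWalkLaw_ae_sum_le hH hψ hT k (20 * n)] with ω hω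
    refine hω.trans ?_
    calc ((20 * n : ℕ) : ℝ) * (k * T) = 1280 * (n : ℝ) ^ 2 * k := by
          simp only [T]; push_cast; ring
      _ ≤ 1280 * (n : ℝ) ^ 2 * (4 * Real.log n) := by gcongr
      _ = _ := by ring
  · rw [repeatedWalkLaw_success hH hψ hT k (20 * n) y]
    exact success_lower (by omega) hP
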